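/- Let $d,k$ be integers with $d\ge 1$, $k\ge 0$, let $H\in(0,1/2)$ and $T>0$. There is a constant $C>0$, depending only on $d,k,H,T$, with the following properties. **Setting.** Let $B=(B_s)_{s\in[0,T]}$ be a $d$-dimensional fractional Brownian motion with Hurst parameter $H$ on a probability space $(\Omega,\mathfrak A,P)$: a centered Gaussian process with a.s. continuous paths and $E[B^{(i)}_tB^{(j)}_s]=\frac{\delta_{ij}}2\left(t^{2H}+s^{2H}-|t-s|^{2H}\right)$. Let $m\ge 1$ be an integer, let $f_1,\dots,f_m:[0,T]\times\mathbb R^d\to\mathbb R$ be smooth with compact support, let $\alpha=(\alpha_1,\dots,\alpha_m)\in(\mathbb N_0^{d})^m$ satisfy $\alpha_j^{(l)}\le k$ for all $j,l$, and let $0\le\theta<t\le T$. Put $\Delta^n_{\theta,t}=\{s\in[0,T]^n:\theta<s_1<\dots<s_n<t\}$. Let $S(m,m)$ be the set of permutations $\sigma$ of $\{1,\dots,2m\}$ with $\sigma(1)<\dots<\sigma(m)$ and $\sigma(m+1)<\dots<\sigma(2m)$. For functions $g_1,\dots,g_m:[0,T]\to\mathbb R$ define, with $s_0:=\theta$, $$\Psi_k[g](\theta,t)=\sum_{\sigma\in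 S(m,m)}\int_{\Delta^{2m}_{\theta,t}}\prod_{j=1}^m\left|g_j(s_{\sigma(j)})\,g_j(s_{\sigma(m+j)})\right|\prod_{j=1}^{2m}|s_j-s_{j-1}|^{-dH(2k+1)}\,ds\in[0,\infty].$$ For $z=(z_1,\dots,z_m)\in(\mathbb R^d)^m$ set $\Psi^f_k(\theta,t,z)=\Psi_k[f_1(\cdot,z_1),\dots,f_m(\cdot,z_m)](\theta,t)$, and for $\kappa_1,\dots,\kappa_m\in L^1([0,T])$ set $\Psi^\kappa_k(\theta,t)=\Psi_k[\kappa_1,\dots,\kappa_m](\theta,t)$. For $R>0$ let $$\Lambda^f_{\alpha,R}(\theta,t,z)=(2\pi)^{-dm}\int_{\{u\in(\mathbb R^d)^m:\,|u|<R\}}\int_{\Delta^m_{\theta,t}}\prod_{j=1}^m f_j(s_j,z_j)\,(-iu_j)^{\alpha_j}\,e^{-i\langle u_j,B_{s_j}-z_j\rangle}\,ds\,du ,$$ and let $\Lambda^f_\alpha(\theta,t,z)$, i.e. the same expression with $u$ integrated over all of $(\mathbb R^d)^m$, be defined as the limit of $\Lambda^f_{\alpha,R}(\theta,t,z)$ in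 $L^2(\Omega)$ as $R\to\infty$. Define $\Lambda^{\kappa f}_\alpha$ in the same way with $f_j(s,x)$ replaced by $\kappa_j(s)f_j(s,x)$. **(i)** If $z\in(\mathbb R^d)^m$ and $\Psi^f_k(\theta,t,z)<\infty$, then $\Lambda^f_\alpha(\theta,t,z)$ is well defined in $L^2(\Omega)$ and $$E\left[|\Lambda^f_\alpha(\theta,t,z)|^2\right]\le C^m\,\Psi^f_k(\theta,t,z).$$ **(ii)** If $\kappa_1,\dots,\kappa_m\in L^1([0,T])$ and $\Psi^\kappa_k(\theta,t)<\infty$, then $\Lambda^{\kappa f}_\alpha(\theta,t,z)$ is well defined in $L^2(\Omega)$ for every $z$, the random field $(z,\omega)\mapsto\Lambda^{\kappa f}_\alpha(\theta,t,z)(\omega)$ has a jointly measurable version, every such version is integrable over $(\mathbb R^d)^m\times\Omega$, and $$\left|E\left[\int_{(\mathbb R^d)^m}\Lambda^{\kappa f}_\alpha(\theta,t,z)\,dz\right]\right|\le C^m\prod_{j=1}^m\|f_j\|_{L^\infty([0,T],L^1(\mathbb R^d))}\;\Psi^\kappa_k(\theta,t)^{1/2}.$$ -/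

import Mathlib

open MeasureTheory ProbabilityTheory Filter Topology
open scoped ENNReal RealInnerProductSpace

namespace FBMLocalTime

/-- `B` restricted to `[0,T]` is a `d`-dimensional fractional Brownian motion with Hurst
parameter `H`: a centered Gaussian process whose components are uncorrelated (hence independent),
each with covariance `(t^{2H} + s^{2H} - |t-s|^{2H}) / 2`, with almost surely continuous paths. -/
structure IsFBM {Ω : Type*} [MeasurableSpace Ω] (P : Measure Ω) (d : ℕ) (H T : ℝ)
    (B : ℝ → Ω → EuclideanSpace ℝ (Fin d)) : Prop where
  measurable : ∀ t ∈ Set.Icc 0 T, Measurable (B t)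
  gaussian : IsGaussianProcess (fun t : Set.Icc (0 : ℝ) T => B t) P
  mean : ∀ t ∈ Set.Icc 0 T, ∀ i, ∫ ω, B t ω i ∂P = 0
  cov : ∀ t ∈ Set.Icc 0 T, ∀ s ∈ Set.Icc 0 T, ∀ i j,
    ∫ ω, B t ω i * B s ω j ∂P =
      if i = j then (t ^ (2 * H) + s ^ (2 * H) - |t - s| ^ (2 * H)) / 2 else 0
  continuous_paths : ∀ᵐ ω ∂P, ContinuousOn (fun t => B t ω) (Set.Icc 0 T)

/-- The open simplex `{θ < s₁ < ⋯ < sₙ < t}`. -/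
def simplex (n : ℕ) (θ t : ℝ) : Set (Fin n → ℝ) :=
  {s | (∀ j, θ < s j ∧ s j < t) ∧ StrictMono s}

/-- The shuffles `S(m,n)`: permutations of `{1,…,m+n}` that are increasing on the first `m`
and on the last `n` indices. -/
noncomputable def shuffles (m n : ℕ) : Finset (Equiv.Perm (Fin (m + n))) := by
  classical exact Finset.univ.filter fun σ =>
    StrictMono (fun i : Fin m => σ (Fin.castAdd n i)) ∧
      StrictMono (fun i : Fin n => σ (Fin.natAdd m i))

/-- The increment `s_j - s_{j-1}`, with the convention `s₀ = θ`. -/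
def gap {n : ℕ} (θ : ℝ) (s : Fin n → ℝ) (j : Fin n) : ℝ :=
  s j - if (j : ℕ) = 0 then θ else s ⟨(j : ℕ) - 1, lt_of_le_of_lt (Nat.sub_le _ _) j.isLt⟩

/-- `Ψ_k(θ,t)` for a family of functions of time `g₁,…,g_m`. For a shuffle `σ` of two copies of
`(1,…,m)`, the `j`-th function of the first copy is evaluated at the time of rank `σ(j)`, that of
the second copy at the time of rank `σ(m+j)`. -/
noncomputable def Psi (d k : ℕ) (H : ℝ) {m : ℕ} (g : Fin m → ℝ → ℝ) (θ t : ℝ) : ℝ≥0∞ :=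
  ∑ σ ∈ shuffles m m, ∫⁻ s in simplex (m + m) θ t,
    ENNReal.ofReal
      ((∏ j : Fin m, |g j (s (σ (Fin.castAdd m j)))| * |g j (s (σ (Fin.natAdd m j)))|) *
        ∏ i : Fin (m + m), |gap θ s i| ^ (-(d * H * (2 * k + 1))))

/-- The Fourier integral defining the random field, with the frequency variable restricted to the
Euclidean ball of radius `R` in `(ℝ^d)^m`. -/
noncomputable def LambdaTrunc {Ω : Type*} {d m : ℕ} (B : ℝ → Ω → EuclideanSpace ℝ (Fin d))
    (f : Fin m → ℝ → EuclideanSpace ℝ (Fin d) → ℝ) (α : Fin m → Fin d → ℕ) (θ t : ℝ)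
    (z : Fin m → EuclideanSpace ℝ (Fin d)) (R : ℝ) (ω : Ω) : ℂ :=
  (((2 * Real.pi : ℝ) : ℂ) ^ (d * m))⁻¹ *
    ∫ u in {u : Fin m → EuclideanSpace ℝ (Fin d) | ∑ j, ‖u j‖ ^ 2 < R ^ 2},
      ∫ s in simplex m θ t,
        ∏ j, ((f j (s j) (z j) : ℝ) : ℂ) *
          (∏ l, (-Complex.I * ((u j l : ℝ) : ℂ)) ^ (α j l)) *
          Complex.exp (-Complex.I * ((⟪u j, B (s j) ω - z j⟫ : ℝ) : ℂ))

/-- `L` is (a version of) `Λ^f_α(θ,t,z)`: it belongs to `L²(Ω)` and is the `L²(Ω)`-limit of the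
truncated Fourier integrals as `R → ∞`. -/
def IsLambda {Ω : Type*} [MeasurableSpace Ω] (P : Measure Ω) {d m : ℕ}
    (B : ℝ → Ω → EuclideanSpace ℝ (Fin d))
    (f : Fin m → ℝ → EuclideanSpace ℝ (Fin d) → ℝ) (α : Fin m → Fin d → ℕ) (θ t : ℝ)
    (z : Fin m → EuclideanSpace ℝ (Fin d)) (L : Ω → ℂ) : Prop :=
  (∀ R : ℝ, MemLp (LambdaTrunc B f α θ t z R) 2 P) ∧ MemLp L 2 P ∧
    Tendsto (fun R : ℝ => eLpNorm (fun ω => LambdaTrunc B f α θ t z R ω - L ω) 2 P)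
      atTop (𝓝 0)

/-- `L` is a jointly measurable version of the random field `z ↦ Λ^f_α(θ,t,z)`. -/
def IsLambdaField {Ω : Type*} [MeasurableSpace Ω] (P : Measure Ω) {d m : ℕ}
    (B : ℝ → Ω → EuclideanSpace ℝ (Fin d))
    (f : Fin m → ℝ → EuclideanSpace ℝ (Fin d) → ℝ) (α : Fin m → Fin d → ℕ) (θ t : ℝ)
    (L : (Fin m → EuclideanSpace ℝ (Fin d)) → Ω → ℂ) : Prop :=
  Measurable (Function.uncurry L) ∧ ∀ z, IsLambda P B f α θ t z (L z)

/-- `f` restricted to `[0,T] × ℝ^d` is smooth with compact support. -/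
def IsSmoothCompact {d : ℕ} (T : ℝ) (f : ℝ → EuclideanSpace ℝ (Fin d) → ℝ) : Prop :=
  ContDiffOn ℝ ((⊤ : ℕ∞) : WithTop ℕ∞) (Function.uncurry f) (Set.Icc 0 T ×ˢ Set.univ) ∧
    ∃ K : Set (EuclideanSpace ℝ (Fin d)), IsCompact K ∧ ∀ s ∈ Set.Icc 0 T, ∀ x ∉ K, f s x = 0

/-- The norm of `L^∞([0,T], L¹(ℝ^d))`. -/
noncomputable def normLinftyL1 {d : ℕ} (T : ℝ) (f : ℝ → EuclideanSpace ℝ (Fin d) → ℝ) : ℝ≥0∞ :=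
  essSup (fun s => ∫⁻ x, ‖f s x‖ₑ) (volume.restrict (Set.Icc 0 T))

end FBMLocalTime

/-!
The proof rests on local nondeterminism of fractional Brownian motion with constants that do not
depend on the number of times. For `H < 1/2` the covariance `fbmCov H s t` is the inner product in
`L²` of the functions `(x, u) ↦ 1_(0,s](x) - 1_(0,s](x + u)`, for the measure
`H (1 - 2H) u^(2H-2) dx du` on pairs of points `x < x + u` (`inner_fbmVec`). In this picture the
variance of `∑ v i B (s i)` is the integral of the squared increments of a step function that jumps
by `v i` at `s i`. Around different jumps there are disjoint boxes of pairs that see only one jump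
each, and the mass of the box at `s j` is at least a multiple of `δ j ^ (2H)`, if `δ j` is the
distance of `s j` from the other times and from `0` (`local_nondeterminism`).

For times in increasing order this is used twice. With `δ j` the distance to both neighbours, half
of the Gaussian weight `exp (-Var/2)` absorbs the polynomial factor `∏ |v j l| ^ α j l`
(`prod_pow_mul_exp_le`). With `δ j` the distance to the preceding time, it bounds the conditional
variances from below and hence the Gaussian integral of the other half from above, by integrating
out one frequency variable at a time (`lintegral_exp_neg_gram_le`). The result is the bound
`K ^ n ∏ gap ^ (-dH(2k+1))` for the Gaussian moments at `n` times (`exists_lintegral_moment_le`).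

The second moment of the Fourier integral over a set of frequencies is, by Fubini's theorem, at most
an integral of such Gaussian moments over pairs of increasing vectors of times; almost every pair is
merged into one vector of `2m` increasing times by a unique shuffle, which gives `K ^ (2m) Ψ`
(`lintegral_enorm_lambdaOn_sq_le`, `pairMoment_univ_le`). The same integral with the frequencies
restricted to the complement of a ball tends to zero by dominated convergence, and it does not
depend on `z`, except through the weights. Hence the truncated integrals are Cauchy in `L²(Ω)`; for
weights `κ j * f j` with `f j` bounded they are so uniformly in `z`, and almost sure convergence
along a subsequence yields a jointly measurable limit (`exists_limit_lambdaOn`).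

For the integral over `z`, only the first moment is needed after Fubini's theorem. It is bounded by
an integral over a single simplex (`enorm_integral_lambdaOn_le`), where the integration over `z`
produces the norms of the `f j` (`lintegral_setLIntegral_simplex_le`). The square of what remains is
at most `Ψ`, because gaps between times shrink when two vectors of times are merged
(`sq_setLIntegral_simplex_le_Psi`).
-/

namespace FBMLocalTime

/-! ### Local nondeterminism from a representation of the covariance -/

/-- The covariance function of one-dimensional fractional Brownian motion, for `s, t ≥ 0`. -/
noncomputable def fbmCov (H s t : ℝ) : ℝ := (s ^ (2 * H) + t ^ (2 * H) - |s - t| ^ (2 * H)) / 2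

/-- The measure `H (1 - 2H) u^{2H-2} dx du` on `ℝ × (0,∞)`; a point `(x, u)` stands for the pair
`x < x + u`. The constant is chosen so that the pairs with exactly one point in a given interval of
length `L` have mass `L^{2H}`. -/
noncomputable def jumpMeasure (H : ℝ) : Measure (ℝ × ℝ) :=
  (volume : Measure ℝ).prod ((volume.restrict (Set.Ioi 0)).withDensity
    fun u => ENNReal.ofReal (H * (1 - 2 * H) * u ^ (2 * H - 2)))

/-- The difference of the indicator function of `(a, b]` between the ends of the pair
`(x, x + u)`. -/
noncomputable def incr (a b : ℝ) (p : ℝ × ℝ) : ℝ :=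
  (Set.Ioc a b).indicator 1 p.1 - (Set.Ioc a b).indicator 1 (p.1 + p.2)

lemma measurable_incr (a b : ℝ) : Measurable (incr a b) := by
  unfold incr
  exact ((measurable_const.indicator measurableSet_Ioc).comp measurable_fst).sub
    ((measurable_const.indicator measurableSet_Ioc).comp (measurable_fst.add measurable_snd))

/-- For fixed `u`, the points `x` such that exactly one of `x` and `x + u` lies in `(a, b]` make up
two disjoint intervals of length `min u (b - a)`. -/
lemma volume_separating {a b u : ℝ} (hab : a ≤ b) (hu : 0 < u) :
    ∫⁻ x, ENNReal.ofReal (incr a b (x, u) ^ 2) = ENNReal.ofReal (2 * min u (b - a)) := by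
  have h : ∀ x, ENNReal.ofReal (incr a b (x, u) ^ 2) =
      (Set.Ioc (a - u) (min a (b - u)) ∪ Set.Ioc (max a (b - u)) b).indicator 1 x := by
    intro x
    have h1 : (x ∈ Set.Ioc (a - u) (min a (b - u)) ∪ Set.Ioc (max a (b - u)) b) ↔
        ¬ (x ∈ Set.Ioc a b ↔ x + u ∈ Set.Ioc a b) := by
      simp only [Set.mem_union, Set.mem_Ioc, le_min_iff, max_lt_iff]
      constructor
      · rintro (h | h) h' <;> grind
      · intro h
        by_contra h'
        apply h
        constructor <;> intro h2 <;> grind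
    by_cases hx : x ∈ Set.Ioc a b <;> by_cases hy : x + u ∈ Set.Ioc a b <;>
      simp [incr, Set.indicator, h1, hx, hy]
  simp_rw [h]
  rw [lintegral_indicator_one (measurableSet_Ioc.union measurableSet_Ioc),
    measure_union _ measurableSet_Ioc, Real.volume_Ioc, Real.volume_Ioc,
    ← ENNReal.ofReal_add]
  · congr 1
    rcases le_total u (b - a) with h | h
    · rw [min_eq_left (by linarith), max_eq_right (by linarith), min_eq_left h]; ring
    · rw [min_eq_right (by linarith), max_eq_left (by linarith), min_eq_right h]; ring
  · rcases le_total u (b - a) with h | h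
    · rw [min_eq_left (by linarith)]; linarith
    · rw [min_eq_right (by linarith)]; linarith
  · rcases le_total u (b - a) with h | h
    · rw [max_eq_right (by linarith)]; linarith
    · rw [max_eq_left (by linarith)]; linarith
  · rw [Set.disjoint_left]
    intro x hx hx'
    simp only [Set.mem_Ioc, le_min_iff, max_lt_iff] at hx hx'
    linarith [hx.2.1, hx'.1.1]

/-- The normalization of `jumpMeasure`. -/
lemma lintegral_incr_sq {H : ℝ} (hH : 0 < H) (hH' : H < 1 / 2) {a b : ℝ} (hab : a ≤ b) :
    ∫⁻ p, ENNReal.ofReal (incr a b p ^ 2) ∂jumpMeasure H = ENNReal.ofReal ((b - a) ^ (2 * H)) := by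
  have hm : Measurable fun p => ENNReal.ofReal (incr a b p ^ 2) :=
    ((measurable_incr a b).pow_const 2).ennreal_ofReal
  have hd : Measurable fun u : ℝ => ENNReal.ofReal (H * (1 - 2 * H) * u ^ (2 * H - 2)) := by
    fun_prop
  rw [jumpMeasure, lintegral_prod_symm _ hm.aemeasurable,
    lintegral_withDensity_eq_lintegral_mul _ hd hm.lintegral_prod_left']
  have h1 : ∀ u ∈ Set.Ioi (0 : ℝ),
      ((fun u : ℝ => ENNReal.ofReal (H * (1 - 2 * H) * u ^ (2 * H - 2))) *
        fun y => ∫⁻ x, ENNReal.ofReal (incr a b (x, y) ^ 2)) u =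
      ENNReal.ofReal (H * (1 - 2 * H) * u ^ (2 * H - 2) * (2 * min u (b - a))) := by
    intro u hu
    have hu' : 0 < u := hu
    rw [Pi.mul_apply, volume_separating hab hu, ← ENNReal.ofReal_mul]
    have : 0 < 1 - 2 * H := by linarith
    positivity
  rw [setLIntegral_congr_fun measurableSet_Ioi h1]
  rcases hab.eq_or_lt with rfl | hlt
  · rw [sub_self, Real.zero_rpow (by positivity), ENNReal.ofReal_zero]
    refine (setLIntegral_congr_fun (g := fun _ => 0) measurableSet_Ioi
      fun u hu => ?_).trans (by simp)
    simp [min_eq_right (le_of_lt (Set.mem_Ioi.mp hu))]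
  set L := b - a with hL
  have hL0 : 0 < L := by simp [hL, hlt]
  have hH1 : 0 < 1 - 2 * H := by linarith
  rw [← Set.Ioc_union_Ioi_eq_Ioi hL0.le,
    lintegral_union measurableSet_Ioi (by
      rw [Set.disjoint_left]; intro x hx hx'; exact absurd hx.2 (not_le.mpr hx'))]
  have e1 : ∫⁻ u in Set.Ioc 0 L,
      ENNReal.ofReal (H * (1 - 2 * H) * u ^ (2 * H - 2) * (2 * min u L)) =
      ENNReal.ofReal ((1 - 2 * H) * L ^ (2 * H)) := by
    have : ∀ u ∈ Set.Ioc 0 L,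
      ENNReal.ofReal (H * (1 - 2 * H) * u ^ (2 * H - 2) * (2 * min u L)) =
      ENNReal.ofReal (2 * H * (1 - 2 * H) * u ^ (2 * H - 1)) := by
      intro u hu
      rw [min_eq_left hu.2, show 2 * H - 1 = (2 * H - 2) + 1 by ring, Real.rpow_add_one hu.1.ne']
      congr 1; ring
    rw [setLIntegral_congr_fun measurableSet_Ioc this, ← ofReal_integral_eq_lintegral_ofReal]
    · rw [← intervalIntegral.integral_of_le hL0.le, intervalIntegral.integral_const_mul,
        integral_rpow (Or.inl (by linarith))]
      congr 1
      rw [Real.zero_rpow (by linarith), show 2 * H - 1 + 1 = 2 * H by ring]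
      field_simp
      ring
    · have := (intervalIntegral.intervalIntegrable_rpow' (a := 0) (b := L)
        (show -1 < 2 * H - 1 by linarith)).const_mul (2 * H * (1 - 2 * H))
      exact (intervalIntegrable_iff_integrableOn_Ioc_of_le hL0.le).mp this
    · filter_upwards [ae_restrict_mem measurableSet_Ioc] with u hu
      have := hu.1
      positivity
  have e2 : ∫⁻ u in Set.Ioi L,
      ENNReal.ofReal (H * (1 - 2 * H) * u ^ (2 * H - 2) * (2 * min u L)) =
      ENNReal.ofReal (2 * H * L ^ (2 * H)) := by
    have : ∀ u ∈ Set.Ioi L,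
      ENNReal.ofReal (H * (1 - 2 * H) * u ^ (2 * H - 2) * (2 * min u L)) =
      ENNReal.ofReal (2 * H * (1 - 2 * H) * L * u ^ (2 * H - 2)) := by
      intro u hu
      rw [min_eq_right (le_of_lt hu)]
      congr 1; ring
    rw [setLIntegral_congr_fun measurableSet_Ioi this, ← ofReal_integral_eq_lintegral_ofReal]
    · rw [integral_const_mul, integral_Ioi_rpow_of_lt (by linarith) hL0]
      congr 1
      have h2 : L ^ (2 * H) = L ^ (2 * H - 1) * L := by
        rw [← Real.rpow_add_one hL0.ne']; congr 1; ring
      have : 2 * H - 1 ≠ 0 := by linarith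
      rw [h2, show 2 * H - 2 + 1 = 2 * H - 1 by ring]
      field_simp
      ring
    · exact (integrableOn_Ioi_rpow_of_lt (by linarith) hL0).const_mul _
    · filter_upwards [ae_restrict_mem measurableSet_Ioi] with u hu
      have : 0 < u := hL0.trans hu
      positivity
  rw [e1, e2, ← ENNReal.ofReal_add (by positivity) (by positivity)]
  congr 1; ring

lemma memLp_incr {H : ℝ} (hH : 0 < H) (hH' : H < 1 / 2) {a b : ℝ} (hab : a ≤ b) :
    MemLp (incr a b) 2 (jumpMeasure H) := by
  rw [memLp_two_iff_integrable_sq (measurable_incr a b).aestronglyMeasurable]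
  refine ⟨((measurable_incr a b).pow_const 2).aestronglyMeasurable, ?_⟩
  rw [hasFiniteIntegral_iff_ofReal (Eventually.of_forall fun p => sq_nonneg _),
    lintegral_incr_sq hH hH' hab]
  exact ENNReal.ofReal_lt_top

lemma integral_incr_sq {H : ℝ} (hH : 0 < H) (hH' : H < 1 / 2) {a b : ℝ} (hab : a ≤ b) :
    ∫ p, incr a b p ^ 2 ∂jumpMeasure H = (b - a) ^ (2 * H) := by
  rw [integral_eq_lintegral_of_nonneg_ae (Eventually.of_forall fun p => sq_nonneg _)
    ((measurable_incr a b).pow_const 2).aestronglyMeasurable, lintegral_incr_sq hH hH' hab,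
    ENNReal.toReal_ofReal (Real.rpow_nonneg (by linarith) _)]

lemma incr_sub (s t : ℝ) (hs : 0 ≤ s) (hst : s ≤ t) (p : ℝ × ℝ) :
    incr 0 t p - incr 0 s p = incr s t p := by
  have key : ∀ x : ℝ, (Set.Ioc 0 t).indicator (1 : ℝ → ℝ) x =
      (Set.Ioc 0 s).indicator 1 x + (Set.Ioc s t).indicator 1 x := by
    intro x
    simp only [Set.indicator, Set.mem_Ioc, Pi.one_apply]
    split_ifs <;> grind
  simp only [incr, key]
  ring

/-- The covariance of fractional Brownian motion as an inner product in `L²(jumpMeasure H)`. -/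
lemma integral_incr_mul {H : ℝ} (hH : 0 < H) (hH' : H < 1 / 2) {s t : ℝ} (hs : 0 ≤ s)
    (ht : 0 ≤ t) : ∫ p, incr 0 s p * incr 0 t p ∂jumpMeasure H = fbmCov H s t := by
  wlog hst : s ≤ t generalizing s t
  · have := this ht hs (le_of_not_ge hst)
    simp_rw [mul_comm (incr 0 s _)]
    rw [this, fbmCov, fbmCov, abs_sub_comm]
    ring
  have h1 : ∀ p, incr 0 s p * incr 0 t p =
      (incr 0 s p ^ 2 + incr 0 t p ^ 2 - incr s t p ^ 2) / 2 := by
    intro p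
    rw [← incr_sub s t hs hst]
    ring
  have i1 := (memLp_incr hH hH' hs).integrable_sq
  have i2 := (memLp_incr hH hH' ht).integrable_sq
  have i3 := (memLp_incr hH hH' hst).integrable_sq
  simp_rw [h1]
  rw [integral_div, integral_sub (by exact i1.add i2) i3, integral_add i1 i2,
    integral_incr_sq hH hH' hs, integral_incr_sq hH hH' ht, integral_incr_sq hH hH' hst,
    fbmCov, abs_sub_comm, abs_of_nonneg (sub_nonneg.mpr hst), sub_zero, sub_zero]

/-- The vectors representing fractional Brownian motion in `L²(jumpMeasure H)`; the value at `s` is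
meaningful for `0 ≤ s` and `0 < H < 1/2`. -/
noncomputable def fbmVec (H : ℝ) (s : ℝ) : Lp ℝ 2 (jumpMeasure H) := by
  classical
  exact if h : MemLp (incr 0 s) 2 (jumpMeasure H) then h.toLp (incr 0 s) else 0

lemma coeFn_fbmVec {H : ℝ} (hH : 0 < H) (hH' : H < 1 / 2) {s : ℝ} (hs : 0 ≤ s) :
    fbmVec H s =ᵐ[jumpMeasure H] incr 0 s := by
  rw [fbmVec, dif_pos (memLp_incr hH hH' hs)]
  exact MemLp.coeFn_toLp _

lemma inner_fbmVec {H : ℝ} (hH : 0 < H) (hH' : H < 1 / 2) {s t : ℝ} (hs : 0 ≤ s)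
    (ht : 0 ≤ t) : ⟪fbmVec H s, fbmVec H t⟫ = fbmCov H s t := by
  rw [L2.inner_def, ← integral_incr_mul hH hH' hs ht]
  refine integral_congr_ae ?_
  filter_upwards [coeFn_fbmVec hH hH' hs, coeFn_fbmVec hH hH' ht] with p h1 h2
  rw [h1, h2]
  simp [mul_comm]

lemma norm_sq_sum_fbmVec {ι : Type*} [Fintype ι] {H : ℝ} (hH : 0 < H) (hH' : H < 1 / 2) {s : ι → ℝ}
    (hs : ∀ i, 0 ≤ s i) (v : ι → ℝ) :
    ‖∑ i, v i • fbmVec H (s i)‖ ^ 2 = ∑ i, ∑ j, v i * v j * fbmCov H (s i) (s j) := by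
  rw [← real_inner_self_eq_norm_sq, sum_inner]
  refine Finset.sum_congr rfl fun i _ => ?_
  rw [inner_sum]
  refine Finset.sum_congr rfl fun j _ => ?_
  rw [real_inner_smul_left, real_inner_smul_right, inner_fbmVec hH hH' (hs i) (hs j)]
  ring

/-- The pairs `(x, x + u)` with `x ∈ (a - δ/2, a]` and `u ∈ (δ/2, δ]` straddle `a` and remain within
distance `δ` from it. -/
lemma jumpMeasure_box_ge {H : ℝ} (hH : 0 < H) (hH' : H < 1 / 2) (a : ℝ) {δ : ℝ} (hδ : 0 < δ) :
    ENNReal.ofReal (H * (1 - 2 * H) / 4 * δ ^ (2 * H)) ≤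
      jumpMeasure H (Set.Ioc (a - δ / 2) a ×ˢ Set.Ioc (δ / 2) δ) := by
  have hH1 : 0 < 1 - 2 * H := by linarith
  rw [jumpMeasure, Measure.prod_prod, Real.volume_Ioc, withDensity_apply _ measurableSet_Ioc,
    Measure.restrict_restrict measurableSet_Ioc,
    Set.inter_eq_left.mpr (show Set.Ioc (δ / 2) δ ⊆ Set.Ioi 0 from
      fun x hx => lt_trans (by positivity) hx.1)]
  have : ∫⁻ _ in Set.Ioc (δ / 2) δ, ENNReal.ofReal (H * (1 - 2 * H) * δ ^ (2 * H - 2)) ≤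
      ∫⁻ u in Set.Ioc (δ / 2) δ, ENNReal.ofReal (H * (1 - 2 * H) * u ^ (2 * H - 2)) := by
    refine setLIntegral_mono (by fun_prop) fun u hu => ?_
    have hu0 : 0 < u := lt_trans (by positivity) hu.1
    gcongr ENNReal.ofReal (_ * ?_)
    exact Real.rpow_le_rpow_of_nonpos hu0 hu.2 (by linarith)
  refine le_trans ?_ (mul_le_mul_right this _)
  rw [setLIntegral_const, Real.volume_Ioc, ← ENNReal.ofReal_mul (by positivity),
    ← ENNReal.ofReal_mul (by linarith)]
  refine ENNReal.ofReal_le_ofReal (le_of_eq ?_)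
  rw [show 2 * H = (2 * H - 2) + 2 by ring, Real.rpow_add hδ, Real.rpow_two]
  ring_nf

/-- Local nondeterminism with a constant that does not depend on the number of times. Near `s j`,
at scale `δ j`, the step function `∑ i, v i • 1_(0, s i]` has only the jump `v j`, and the pairs of
points on either side of this jump make up a box of mass at least `δ j ^ (2H)`, up to a constant;
the boxes of different jumps are disjoint. -/
theorem local_nondeterminism {ι : Type*} [Fintype ι] {H : ℝ} (hH : 0 < H)
    (hH' : H < 1 / 2) {s δ v : ι → ℝ} (J : Finset ι) (hs : ∀ i, 0 ≤ s i) (hδ : ∀ j ∈ J, 0 < δ j)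
    (hδs : ∀ j ∈ J, δ j ≤ s j) (hsep : ∀ j ∈ J, ∀ i, i ≠ j → v i ≠ 0 → δ j ≤ |s i - s j|) :
    H * (1 - 2 * H) / 4 * ∑ j ∈ J, v j ^ 2 * δ j ^ (2 * H) ≤
      ‖∑ i, v i • fbmVec H (s i)‖ ^ 2 := by
  classical
  set B : ι → Set (ℝ × ℝ) := fun j => Set.Ioc (s j - δ j / 2) (s j) ×ˢ Set.Ioc (δ j / 2) (δ j)
    with hB
  have hBm : ∀ j, MeasurableSet (B j) := fun j => measurableSet_Ioc.prod measurableSet_Ioc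
  have hpt : ∀ p, ∑ j ∈ J, (B j).indicator (fun _ => v j ^ 2) p ≤
      (∑ i, v i * incr 0 (s i) p) ^ 2 := by
    rintro ⟨x, u⟩
    by_cases h : ∃ j ∈ J, v j ≠ 0 ∧ (x, u) ∈ B j
    · obtain ⟨j, hj, hvj, hp⟩ := h
      simp only [hB, Set.mem_prod, Set.mem_Ioc] at hp
      have hδj := hδ j hj
      -- both points of the pair lie within `δ j` of `s j`, hence on the same side of other jumps
      have e0 : ∀ i, i ≠ j → v i ≠ 0 → incr 0 (s i) (x, u) = 0 := by
        intro i hij hvi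
        have h1 := hsep j hj i hij hvi
        have h2 := hδs j hj
        simp only [incr, Set.indicator, Set.mem_Ioc, Pi.one_apply]
        rcases le_abs.mp h1 with h | h
        · rw [if_pos (by constructor <;> linarith [hp.1.1, hp.1.2]),
            if_pos (by constructor <;> linarith [hp.1.1, hp.1.2, hp.2.1, hp.2.2]), sub_self]
        · rw [if_neg (by rintro ⟨h3, h4⟩; linarith [hp.1.1]),
            if_neg (by rintro ⟨h3, h4⟩; linarith [hp.1.1, hp.2.1]), sub_self]
      have e1 : incr 0 (s j) (x, u) = 1 := by
        have h2 := hδs j hj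
        simp only [incr, Set.indicator, Set.mem_Ioc, Pi.one_apply]
        rw [if_pos (by constructor <;> linarith [hp.1.1, hp.1.2]),
          if_neg (by rintro ⟨h3, h4⟩; linarith [hp.1.1, hp.2.1]), sub_zero]
      rw [Finset.sum_eq_single j, Finset.sum_eq_single j, e1]
      · rw [mul_one]
        exact Set.indicator_le_self' (fun _ _ => sq_nonneg _) _
      · intro i _ hij
        by_cases hvi : v i = 0
        · rw [hvi, zero_mul]
        · rw [e0 i hij hvi, mul_zero]
      · intro h; exact absurd (Finset.mem_univ j) h
      · intro i hi hij
        rw [Set.indicator_apply_eq_zero]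
        intro hpi
        by_contra hvi
        have hvi : v i ≠ 0 := fun h => hvi (by simp [h])
        simp only [hB, Set.mem_prod, Set.mem_Ioc] at hpi
        -- a pair in two boxes would straddle two jumps closer to each other than `δ i` or `δ j`
        have h1 := hsep j hj i hij hvi
        have h2 := hsep i hi j (Ne.symm hij) hvj
        rcases le_abs.mp h1 with h | h <;> rcases le_abs.mp h2 with h' | h' <;>
          linarith [hp.1.1, hp.1.2, hpi.1.1, hpi.1.2, hδ i hi]
      · intro h; exact absurd hj h
    · push Not at h
      rw [Finset.sum_eq_zero]
      · positivity
      · intro j hj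
        rw [Set.indicator_apply_eq_zero]
        intro hp
        by_cases hv : v j = 0
        · simp [hv]
        · exact absurd hp (h j hj hv)
  have hval : ENNReal.ofReal (‖∑ i, v i • fbmVec H (s i)‖ ^ 2) =
      ∫⁻ p, ENNReal.ofReal ((∑ i, v i * incr 0 (s i) p) ^ 2) ∂jumpMeasure H := by
    rw [← real_inner_self_eq_norm_sq, L2.inner_def, ofReal_integral_eq_lintegral_ofReal]
    · refine lintegral_congr_ae ?_
      have h1 : (↑(∑ i, v i • fbmVec H (s i)) : ℝ × ℝ → ℝ) =ᵐ[jumpMeasure H]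
          fun p => ∑ i, v i * incr 0 (s i) p := by
        have h2 : ∀ i, (↑(v i • fbmVec H (s i)) : ℝ × ℝ → ℝ) =ᵐ[jumpMeasure H]
            fun p => v i * incr 0 (s i) p := by
          intro i
          filter_upwards [Lp.coeFn_smul (v i) (fbmVec H (s i)),
            coeFn_fbmVec hH hH' (hs i)] with p a b
          rw [a, Pi.smul_apply, b, smul_eq_mul]
        have h3 : (↑(∑ i, v i • fbmVec H (s i)) : ℝ × ℝ → ℝ) =ᵐ[jumpMeasure H]
            fun p => ∑ i, (v i • fbmVec H (s i) : Lp ℝ 2 (jumpMeasure H)) p := by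
          exact Lp.coeFn_fun_finsetSum _ _
        filter_upwards [h3, eventually_countable_forall.mpr h2] with p a b
        rw [a]
        exact Finset.sum_congr rfl fun i _ => b i
      filter_upwards [h1] with p hp
      rw [hp]
      simp [sq]
    · exact L2.integrable_inner (𝕜 := ℝ) (∑ i, v i • fbmVec H (s i)) (∑ i, v i • fbmVec H (s i))
    · exact Eventually.of_forall fun p => real_inner_self_nonneg (F := ℝ)
  have hmain : ENNReal.ofReal (H * (1 - 2 * H) / 4 * ∑ j ∈ J, v j ^ 2 * δ j ^ (2 * H)) ≤
      ENNReal.ofReal (‖∑ i, v i • fbmVec H (s i)‖ ^ 2) := by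
    rw [hval]
    have hH1 : 0 < 1 - 2 * H := by linarith
    calc _ = ∑ j ∈ J, ENNReal.ofReal (v j ^ 2) *
          ENNReal.ofReal (H * (1 - 2 * H) / 4 * δ j ^ (2 * H)) := by
          rw [Finset.mul_sum, ENNReal.ofReal_sum_of_nonneg]
          · refine Finset.sum_congr rfl fun j _ => ?_
            rw [← ENNReal.ofReal_mul (sq_nonneg _)]
            congr 1; ring
          · intro j hj
            have := hδ j hj
            positivity
      _ ≤ ∑ j ∈ J, ENNReal.ofReal (v j ^ 2) * jumpMeasure H (B j) := by
          gcongr with j hj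
          exact jumpMeasure_box_ge hH hH' _ (hδ j hj)
      _ = ∫⁻ p, ∑ j ∈ J, (B j).indicator (fun _ => ENNReal.ofReal (v j ^ 2)) p ∂jumpMeasure H := by
          rw [lintegral_finsetSum _ fun j _ => measurable_const.indicator (hBm j)]
          refine Finset.sum_congr rfl fun j _ => ?_
          rw [lintegral_indicator_const (hBm j)]
      _ ≤ _ := by
          refine lintegral_mono fun p => ?_
          refine le_trans (le_of_eq ?_) (ENNReal.ofReal_le_ofReal (hpt p))
          rw [ENNReal.ofReal_sum_of_nonneg]
          · refine Finset.sum_congr rfl fun j _ => ?_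
            by_cases hp : p ∈ B j <;> simp [hp]
          · intro j _
            exact Set.indicator_nonneg (fun _ _ => sq_nonneg _) _
  exact (ENNReal.ofReal_le_ofReal_iff (sq_nonneg _)).mp hmain

/-! ### Gaussian integrals, gaps and the covariance form -/

lemma lintegral_exp_neg_mul_sq_norm_add {d : ℕ} {a : ℝ} (ha : 0 < a)
    (c : EuclideanSpace ℝ (Fin d)) :
    ∫⁻ v : EuclideanSpace ℝ (Fin d), ENNReal.ofReal (Real.exp (-(a * ‖v + c‖ ^ 2))) =
      ENNReal.ofReal ((Real.pi / a) ^ ((d : ℝ) / 2)) := by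
  rw [lintegral_add_right_eq_self
    (fun v : EuclideanSpace ℝ (Fin d) => ENNReal.ofReal (Real.exp (-(a * ‖v‖ ^ 2)))) c]
  have h := GaussianFourier.integral_rexp_neg_mul_sq_norm (V := EuclideanSpace ℝ (Fin d)) ha
  rw [finrank_euclideanSpace_fin] at h
  simp_rw [neg_mul] at h
  rw [← h, ofReal_integral_eq_lintegral_ofReal]
  · by_contra hn
    rw [integral_undef hn] at h
    have : 0 < (Real.pi / a) ^ ((d : ℝ) / 2) := by positivity
    linarith
  · exact Eventually.of_forall fun v => (Real.exp_pos _).le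

lemma lintegral_fin_succ {E : Type*} [MeasureSpace E] [SigmaFinite (volume : Measure E)] (n : ℕ)
    {f : (Fin (n + 1) → E) → ℝ≥0∞} (hf : Measurable f) :
    ∫⁻ v, f v = ∫⁻ w : Fin n → E, ∫⁻ x : E, f (Fin.cons x w : Fin (n + 1) → E) := by
  have h := (volume_preserving_piFinSuccAbove (fun _ : Fin (n + 1) => E) 0).symm
  rw [← h.lintegral_comp hf, Measure.volume_eq_prod, lintegral_prod_symm]
  · simp [MeasurableEquiv.piFinSuccAbove, Fin.insertNthEquiv]
  · exact (hf.comp h.measurable).aemeasurable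

/-- A Gaussian integral is bounded through the conditional variances: if the squared distance of the
vector `x j` from the span of its predecessors is at least `D j`, the determinant of the Gram matrix
is at least `∏ j, D j`. The frequency variable takes values in `ℝ^d`, one copy of the quadratic form
for each coordinate. The induction integrates out the first variable, which replaces the remaining
vectors by their projections orthogonal to `x 0`. -/
lemma lintegral_exp_neg_gram_le {E : Type*} [NormedAddCommGroup E] [InnerProductSpace ℝ E] (d : ℕ) :
    ∀ (n : ℕ) (x : Fin n → E) (D : Fin n → ℝ), (∀ j, 0 < D j) →
      (∀ (j : Fin n) (w : Fin n → ℝ), (∀ i, j < i → w i = 0) →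
        D j * w j ^ 2 ≤ ‖∑ i, w i • x i‖ ^ 2) →
      ∫⁻ v : Fin n → EuclideanSpace ℝ (Fin d),
        ENNReal.ofReal (Real.exp (-∑ l, ‖∑ i, v i l • x i‖ ^ 2)) ≤
      ∏ j, ENNReal.ofReal ((Real.pi / D j) ^ ((d : ℝ) / 2)) := by
  intro n
  induction n with
  | zero =>
    intro x D _ _
    rw [volume_pi, Measure.pi_of_empty]
    simp
  | succ n ih =>
    intro x D hD hx
    have ha : D 0 ≤ ‖x 0‖ ^ 2 := by
      have := hx 0 (Pi.single 0 1) (fun i hi => Pi.single_eq_of_ne (ne_of_gt hi) _)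
      rw [Finset.sum_eq_single 0 (fun i _ hi => by rw [Pi.single_eq_of_ne hi, zero_smul])
        (fun h => absurd (Finset.mem_univ _) h)] at this
      simpa using this
    set a := ‖x 0‖ ^ 2 with hadef
    have ha0 : 0 < a := (hD 0).trans_le ha
    set b : Fin n → ℝ := fun i => ⟪x 0, x i.succ⟫ / a with hb
    set y : Fin n → E := fun i => x i.succ - b i • x 0 with hy
    have horth : ∀ i, ⟪x 0, y i⟫ = 0 := by
      intro i
      rw [hy, inner_sub_right, inner_smul_right, real_inner_self_eq_norm_sq, ← hadef, hb]
      field_simp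
      ring
    have hdecomp : ∀ (p : ℝ) (w : Fin n → ℝ),
        ‖p • x 0 + ∑ i, w i • x i.succ‖ ^ 2 =
          a * (p + ∑ i, w i * b i) ^ 2 + ‖∑ i, w i • y i‖ ^ 2 := by
      intro p w
      have e : p • x 0 + ∑ i, w i • x i.succ =
          (p + ∑ i, w i * b i) • x 0 + ∑ i, w i • y i := by
        simp only [hy, smul_sub, Finset.sum_sub_distrib, add_smul, Finset.sum_smul, mul_smul]
        abel
      have o : ⟪(p + ∑ i, w i * b i) • x 0, ∑ i, w i • y i⟫ = 0 := by
        rw [inner_sum]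
        refine Finset.sum_eq_zero fun i _ => ?_
        rw [real_inner_smul_left, real_inner_smul_right, horth]
        simp
      rw [e, sq ‖_ + _‖, norm_add_sq_eq_norm_sq_add_norm_sq_of_inner_eq_zero _ _ o,
        norm_smul, hadef, Real.norm_eq_abs, ← sq_abs (p + _)]
      ring
    have hy' : ∀ (j : Fin n) (w : Fin n → ℝ), (∀ i, j < i → w i = 0) →
        D j.succ * w j ^ 2 ≤ ‖∑ i, w i • y i‖ ^ 2 := by
      intro j w hw
      have h1 := hx j.succ (Fin.cons (-∑ i, w i * b i) w) (fun i => by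
        refine Fin.cases (fun h => absurd h (by simp)) (fun i h => ?_) i
        simpa using hw i (by simpa using h))
      rw [Fin.sum_univ_succ] at h1
      simp only [Fin.cons_zero, Fin.cons_succ] at h1
      rw [hdecomp] at h1
      simpa using h1
    have hI := ih y (fun j => D j.succ) (fun j => hD _) hy'
    have hcont : Continuous fun v : Fin (n + 1) → EuclideanSpace ℝ (Fin d) =>
        Real.exp (-∑ l, ‖∑ i, v i l • x i‖ ^ 2) := by fun_prop
    rw [lintegral_fin_succ _ hcont.measurable.ennreal_ofReal, Fin.prod_univ_succ]
    have hin : ∀ w : Fin n → EuclideanSpace ℝ (Fin d),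
        ∫⁻ p : EuclideanSpace ℝ (Fin d), ENNReal.ofReal (Real.exp
          (-∑ l, ‖∑ i, (Fin.cons p w : Fin (n + 1) → EuclideanSpace ℝ (Fin d)) i l • x i‖ ^ 2)) ≤
        ENNReal.ofReal ((Real.pi / D 0) ^ ((d : ℝ) / 2)) *
          ENNReal.ofReal (Real.exp (-∑ l, ‖∑ i, w i l • y i‖ ^ 2)) := by
      intro w
      have e : ∀ p : EuclideanSpace ℝ (Fin d), ENNReal.ofReal (Real.exp
          (-∑ l, ‖∑ i, (Fin.cons p w : Fin (n + 1) → EuclideanSpace ℝ (Fin d)) i l • x i‖ ^ 2)) =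
          ENNReal.ofReal (Real.exp (-(a * ‖p + ∑ i, b i • w i‖ ^ 2))) *
            ENNReal.ofReal (Real.exp (-∑ l, ‖∑ i, w i l • y i‖ ^ 2)) := by
        intro p
        rw [← ENNReal.ofReal_mul (Real.exp_pos _).le, ← Real.exp_add]
        congr 2
        rw [EuclideanSpace.norm_sq_eq, Finset.mul_sum, ← neg_add, ← Finset.sum_add_distrib]
        congr 1
        refine Finset.sum_congr rfl fun l _ => ?_
        rw [Fin.sum_univ_succ]
        simp only [Fin.cons_zero, Fin.cons_succ]
        rw [hdecomp, Real.norm_eq_abs, sq_abs]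
        simp [mul_comm]
      simp_rw [e]
      rw [lintegral_mul_const' _ _ ENNReal.ofReal_ne_top, lintegral_exp_neg_mul_sq_norm_add ha0]
      gcongr
      exact hD 0
    refine (lintegral_mono hin).trans ?_
    rw [lintegral_const_mul' _ _ ENNReal.ofReal_ne_top]
    gcongr

section gap

variable {n : ℕ} {θ t : ℝ} {s : Fin n → ℝ}

lemma gap_le_sub (hs : s ∈ simplex n θ t) {i j : Fin n} (hij : i < j) :
    gap θ s j ≤ s j - s i := by
  have hij' : (i : ℕ) < j := hij
  rw [gap, if_neg (by omega)]
  gcongr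
  refine hs.2.monotone ?_
  rw [Fin.le_def]
  change (i : ℕ) ≤ j - 1
  omega

lemma gap_pos (hs : s ∈ simplex n θ t) (j : Fin n) : 0 < gap θ s j := by
  rw [gap, sub_pos]
  split_ifs with h
  · exact (hs.1 j).1
  · refine hs.2 ?_
    rw [Fin.lt_def]
    change (j : ℕ) - 1 < j
    omega

lemma gap_le_sub_left (hs : s ∈ simplex n θ t) (j : Fin n) : gap θ s j ≤ s j - θ := by
  rw [gap]
  split_ifs with h
  · exact le_rfl
  · gcongr
    exact (hs.1 _).1.le

lemma gap_le {T : ℝ} (hs : s ∈ simplex n θ t) (hθ : 0 ≤ θ) (ht : t ≤ T) (j : Fin n) :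
    gap θ s j ≤ T := by
  have := gap_le_sub_left hs j
  have := (hs.1 j).2
  linarith

lemma measurable_gap (j : Fin n) : Measurable fun s : Fin n → ℝ => gap θ s j := by
  unfold gap
  split_ifs <;> fun_prop

end gap

lemma measurableSet_simplex (n : ℕ) (θ t : ℝ) : MeasurableSet (simplex n θ t) := by
  have : simplex n θ t = (⋂ j, {s | θ < s j} ∩ {s | s j < t}) ∩
      ⋂ i, ⋂ j, {s | i < j → s i < s j} := by
    ext s
    simp [simplex, StrictMono]
  rw [this]
  refine (MeasurableSet.iInter fun j => ?_).inter
    (MeasurableSet.iInter fun i => MeasurableSet.iInter fun j => ?_)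
  · exact (measurableSet_lt measurable_const (measurable_pi_apply j)).inter
      (measurableSet_lt (measurable_pi_apply j) measurable_const)
  · by_cases h : i < j
    · simpa [h] using measurableSet_lt (measurable_pi_apply i) (measurable_pi_apply j)
    · simp [h]

/-- The variance of `∑ j, ⟪v j, B (s j)⟫` for a `d`-dimensional fractional Brownian motion. -/
noncomputable def covForm {ι : Type*} [Fintype ι] {d : ℕ} (H : ℝ) (s : ι → ℝ)
    (v : ι → EuclideanSpace ℝ (Fin d)) : ℝ :=
  ∑ l, ∑ i, ∑ j, v i l * v j l * fbmCov H (s i) (s j)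

lemma covForm_eq {ι : Type*} [Fintype ι] {d : ℕ} {H : ℝ} (hH : 0 < H) (hH' : H < 1 / 2) {s : ι → ℝ}
    (hs : ∀ i, 0 ≤ s i) (v : ι → EuclideanSpace ℝ (Fin d)) :
    covForm H s v = ∑ l, ‖∑ i, v i l • fbmVec H (s i)‖ ^ 2 := by
  rw [covForm]
  exact Finset.sum_congr rfl fun l _ => (norm_sq_sum_fbmVec hH hH' hs _).symm

/-- The conditional variance at the `j`-th time given the earlier ones, bounded from below by the
gap in front of it. -/
lemma gap_rpow_mul_le {n : ℕ} {H θ t : ℝ} (hH : 0 < H) (hH' : H < 1 / 2) (hθ : 0 ≤ θ)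
    {s : Fin n → ℝ} (hs : s ∈ simplex n θ t) (j : Fin n) (w : Fin n → ℝ)
    (hw : ∀ i, j < i → w i = 0) :
    H * (1 - 2 * H) / 4 * gap θ s j ^ (2 * H) * w j ^ 2 ≤ ‖∑ i, w i • fbmVec H (s i)‖ ^ 2 := by
  have hs0 : ∀ i, 0 ≤ s i := fun i => hθ.trans (hs.1 i).1.le
  have := local_nondeterminism hH hH' (s := s) (δ := gap θ s) (v := w) {j} hs0
    (fun i _ => gap_pos hs i)
    (fun i _ => (gap_le_sub_left hs i).trans (by linarith)) (by
      intro i hi i' hne hv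
      rw [Finset.mem_singleton] at hi
      subst hi
      have hlt : i' < i := by
        rcases lt_trichotomy i' i with h | h | h
        · exact h
        · exact absurd h hne
        · exact absurd (hw _ h) hv
      rw [abs_sub_comm]
      exact (gap_le_sub hs hlt).trans (le_abs_self _))
  rw [Finset.sum_singleton] at this
  linarith

/-- A power of `x` times a Gaussian of width `y⁻¹` is at most of the order of the same power of the
width, uniformly in `y`. -/
lemma pow_mul_exp_neg_le {b : ℝ} (hb : 0 < b) {k β : ℕ} (hβ : β ≤ k) {x y : ℝ} (hx : 0 ≤ x)
    (hy : 0 < y) :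
    x ^ β * Real.exp (-(b * (x * y) ^ 2)) ≤ (k.factorial / b ^ k * Real.exp b) * y⁻¹ ^ β := by
  have h1 : (x * y) ^ β ≤ (1 + (x * y) ^ 2) ^ k := by
    refine le_trans (pow_le_pow_left₀ (by positivity) (?_ : x * y ≤ 1 + (x * y) ^ 2) β)
      (pow_le_pow_right₀ (by nlinarith [sq_nonneg (x * y)]) hβ)
    nlinarith [sq_nonneg (x * y - 1)]
  have h2 : (b * (1 + (x * y) ^ 2)) ^ k / k.factorial ≤ Real.exp (b * (1 + (x * y) ^ 2)) :=
    Real.pow_div_factorial_le_exp _ (by positivity) _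
  have h3 : (1 + (x * y) ^ 2) ^ k ≤
      k.factorial / b ^ k * Real.exp b * Real.exp (b * (x * y) ^ 2) := by
    rw [mul_assoc, ← Real.exp_add, ← mul_one_add, div_mul_eq_mul_div, le_div_iff₀ (by positivity),
      ← mul_pow, mul_comm _ b]
    rwa [div_le_iff₀ (by positivity), mul_comm (Real.exp _)] at h2
  have e : x ^ β = (x * y) ^ β * y⁻¹ ^ β := by
    rw [← mul_pow, mul_assoc, mul_inv_cancel₀ hy.ne', mul_one]
  rw [e, Real.exp_neg]
  have := h1.trans h3
  calc _ = ((x * y) ^ β * (Real.exp (b * (x * y) ^ 2))⁻¹) * y⁻¹ ^ β := by ring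
    _ ≤ _ := by
      refine mul_le_mul_of_nonneg_right ?_ (by positivity)
      rwa [← div_eq_mul_inv, div_le_iff₀ (Real.exp_pos _)]

/-! ### Polynomial moments against the covariance form -/

/-- Shifting the index of factors `≥ 1` by one, with the last factor replaced by `1`, loses the
first factor and so decreases the product. -/
lemma prod_next_le : ∀ {n : ℕ} {f : Fin n → ℝ}, (∀ j, 1 ≤ f j) →
    ∏ j : Fin n, (if h : (j : ℕ) + 1 < n then f ⟨j + 1, h⟩ else 1) ≤ ∏ j, f j := by
  intro n f hf
  cases n with
  | zero => simp
  | succ n =>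
    rw [Fin.prod_univ_castSucc, Fin.prod_univ_succ]
    have h1 : ∏ i : Fin n, (if h : ((i.castSucc : Fin (n + 1)) : ℕ) + 1 < n + 1 then
        f ⟨(i.castSucc : Fin (n + 1)) + 1, h⟩ else 1) = ∏ i : Fin n, f i.succ := by
      refine Finset.prod_congr rfl fun i _ => ?_
      rw [dif_pos (by simp)]
      rfl
    rw [h1, dif_neg (by simp), mul_one]
    exact le_mul_of_one_le_left (Finset.prod_nonneg fun i _ => zero_le_one.trans (hf _)) (hf 0)

/-- The distance from the `j`-th time to its neighbours on both sides; the preceding neighbour of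
the first time is `θ`, the last time has no following neighbour. -/
noncomputable def sep {n : ℕ} (θ : ℝ) (s : Fin n → ℝ) (j : Fin n) : ℝ :=
  if h : (j : ℕ) + 1 < n then min (gap θ s j) (gap θ s ⟨j + 1, h⟩) else gap θ s j

lemma sep_pos {n : ℕ} {θ t : ℝ} {s : Fin n → ℝ} (hs : s ∈ simplex n θ t) (j : Fin n) :
    0 < sep θ s j := by
  unfold sep
  split_ifs
  · exact lt_min (gap_pos hs _) (gap_pos hs _)
  · exact gap_pos hs _

lemma sep_le_gap {n : ℕ} (θ : ℝ) (s : Fin n → ℝ) (j : Fin n) : sep θ s j ≤ gap θ s j := by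
  unfold sep
  split_ifs
  · exact min_le_left _ _
  · exact le_rfl

lemma sep_le_abs_sub {n : ℕ} {θ t : ℝ} {s : Fin n → ℝ} (hs : s ∈ simplex n θ t) {i j : Fin n}
    (hij : i ≠ j) : sep θ s j ≤ |s i - s j| := by
  rcases lt_or_gt_of_ne hij with h | h
  · rw [abs_sub_comm]
    exact (sep_le_gap θ s j).trans ((gap_le_sub hs h).trans (le_abs_self _))
  · have hlt : (j : ℕ) < i := h
    have hn : (j : ℕ) + 1 < n := by have := i.isLt; omega
    refine le_trans ?_ (le_abs_self _)
    rw [sep, dif_pos hn]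
    refine (min_le_right _ _).trans ((gap_le_sub hs (i := j) (by simp [Fin.lt_def])).trans ?_)
    gcongr
    exact hs.2.monotone (by rw [Fin.le_def]; change (j : ℕ) + 1 ≤ i; omega)

/-- Local nondeterminism for all times simultaneously, in each coordinate. -/
lemma sum_sep_le_covForm {n d : ℕ} {H θ t : ℝ} (hH : 0 < H) (hH' : H < 1 / 2) (hθ : 0 ≤ θ)
    {s : Fin n → ℝ} (hs : s ∈ simplex n θ t) (v : Fin n → EuclideanSpace ℝ (Fin d)) :
    ∑ j, ∑ l, H * (1 - 2 * H) / 4 * (|v j l| * sep θ s j ^ H) ^ 2 ≤ covForm H s v := by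
  have hs0 : ∀ i, 0 ≤ s i := fun i => hθ.trans (hs.1 i).1.le
  rw [covForm_eq hH hH' hs0, Finset.sum_comm]
  refine Finset.sum_le_sum fun l _ => ?_
  refine le_trans (le_of_eq ?_) (local_nondeterminism hH hH' (s := s) (δ := sep θ s)
    (v := fun j => v j l) Finset.univ hs0 (fun j _ => sep_pos hs j)
    (fun j _ => (sep_le_gap θ s j).trans ((gap_le_sub_left hs j).trans (by linarith)))
    (fun j _ i hij _ => sep_le_abs_sub hs hij))
  rw [Finset.mul_sum]
  refine Finset.sum_congr rfl fun j _ => ?_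
  rw [mul_pow, sq_abs, mul_comm 2 H, Real.rpow_mul (sep_pos hs j).le, Real.rpow_two]

/-- The scaled gaps `gap / a` are at most `1`, so that the negative power of the minimum of two
gaps is at most the product of their negative powers. -/
lemma inv_rpow_sep_le {n : ℕ} {H T a θ t : ℝ} (hH : 0 < H) (hθ : 0 ≤ θ) (ht : t ≤ T) (hTa : T ≤ a)
    (ha : 1 ≤ a) {s : Fin n → ℝ} (hs : s ∈ simplex n θ t) (j : Fin n) :
    (sep θ s j ^ H)⁻¹ ≤ (gap θ s j / a) ^ (-H) *
      (if h : (j : ℕ) + 1 < n then (gap θ s ⟨j + 1, h⟩ / a) ^ (-H) else 1) := by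
  have ha0 : 0 < a := by linarith
  have h1 : ∀ i, 1 ≤ (gap θ s i / a) ^ (-H) := fun i =>
    Real.one_le_rpow_of_pos_of_le_one_of_nonpos (div_pos (gap_pos hs i) ha0)
      ((div_le_one ha0).mpr ((gap_le hs hθ ht i).trans hTa)) (by linarith)
  have h2 : ∀ i, (gap θ s i ^ H)⁻¹ ≤ (gap θ s i / a) ^ (-H) := fun i => by
    rw [← Real.rpow_neg (gap_pos hs i).le]
    exact Real.rpow_le_rpow_of_nonpos (div_pos (gap_pos hs i) ha0)
      (div_le_self (gap_pos hs i).le ha) (by linarith)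
  unfold sep
  split_ifs with h
  · rcases min_choice (gap θ s j) (gap θ s ⟨j + 1, h⟩) with e | e <;> rw [e]
    · exact (h2 j).trans (le_mul_of_one_le_right (zero_le_one.trans (h1 _)) (h1 _))
    · exact (h2 _).trans (le_mul_of_one_le_left (zero_le_one.trans (h1 _)) (h1 _))
  · rw [mul_one]
    exact h2 j

/-- Half of the Gaussian weight absorbs the polynomial factor: it turns `|v j l|^β` into a power
of the distance from `s j` to its neighbours, which is split between the two adjacent gaps. -/
lemma prod_pow_mul_exp_le {n d k : ℕ} {H T a θ t : ℝ} (hH : 0 < H) (hH' : H < 1 / 2) (hθ : 0 ≤ θ)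
    (ht : t ≤ T) (hTa : T ≤ a) (ha : 1 ≤ a) {s : Fin n → ℝ} (hs : s ∈ simplex n θ t)
    {β : Fin n → Fin d → ℕ} (hβ : ∀ j l, β j l ≤ k) (v : Fin n → EuclideanSpace ℝ (Fin d)) :
    (∏ j, ∏ l, |v j l| ^ β j l) * Real.exp (-(covForm H s v / 4)) ≤
      ∏ j, ((k.factorial / (H * (1 - 2 * H) / 16) ^ k * Real.exp (H * (1 - 2 * H) / 16)) ^ d *
        ((gap θ s j / a) ^ (-H)) ^ (2 * k * d)) := by
  have hH1 : 0 < 1 - 2 * H := by linarith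
  have ha0 : 0 < a := by linarith
  set b := H * (1 - 2 * H) / 16 with hb
  have hb0 : 0 < b := by positivity
  set M := (k.factorial : ℝ) / b ^ k * Real.exp b with hM
  have hM0 : 0 < M := by positivity
  set h : Fin n → ℝ := fun j => (gap θ s j / a) ^ (-H) with hh
  set h' : Fin n → ℝ := fun j => if hj : (j : ℕ) + 1 < n then h ⟨j + 1, hj⟩ else 1 with hh'
  have h1 : ∀ i, 1 ≤ h i := fun i =>
    Real.one_le_rpow_of_pos_of_le_one_of_nonpos (div_pos (gap_pos hs i) ha0)
      ((div_le_one ha0).mpr ((gap_le hs hθ ht i).trans hTa)) (by linarith)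
  have h1' : ∀ i, 1 ≤ h' i := fun i => by
    simp only [hh']; split_ifs
    · exact h1 _
    · exact le_rfl
  have hexp : Real.exp (-(covForm H s v / 4)) ≤
      ∏ j, ∏ l, Real.exp (-(b * (|v j l| * sep θ s j ^ H) ^ 2)) := by
    simp_rw [← Real.exp_sum]
    refine Real.exp_le_exp.mpr ?_
    have := sum_sep_le_covForm hH hH' hθ hs v
    simp only [Finset.sum_neg_distrib, neg_le_neg_iff]
    have e : ∑ j, ∑ l, b * (|v j l| * sep θ s j ^ H) ^ 2 =
        (∑ j, ∑ l, H * (1 - 2 * H) / 4 * (|v j l| * sep θ s j ^ H) ^ 2) / 4 := by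
      simp_rw [Finset.sum_div]
      refine Finset.sum_congr rfl fun j _ => Finset.sum_congr rfl fun l _ => ?_
      rw [hb]; ring
    rw [e]
    linarith
  calc _ ≤ (∏ j, ∏ l, |v j l| ^ β j l) *
        ∏ j, ∏ l, Real.exp (-(b * (|v j l| * sep θ s j ^ H) ^ 2)) := by
        gcongr
    _ = ∏ j, ∏ l, |v j l| ^ β j l * Real.exp (-(b * (|v j l| * sep θ s j ^ H) ^ 2)) := by
        simp_rw [Finset.prod_mul_distrib]
    _ ≤ ∏ j, ∏ _l : Fin d, M * (h j * h' j) ^ k := by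
        refine Finset.prod_le_prod (fun j _ => by positivity) fun j _ => ?_
        refine Finset.prod_le_prod (fun l _ => by positivity) fun l _ => ?_
        have hp : 0 < sep θ s j ^ H := Real.rpow_pos_of_pos (sep_pos hs j) _
        refine (pow_mul_exp_neg_le hb0 (hβ j l) (abs_nonneg _) hp).trans ?_
        gcongr
        refine (pow_le_pow_left₀ (by positivity)
          (inv_rpow_sep_le hH hθ ht hTa ha hs j) _).trans ?_
        exact pow_le_pow_right₀ (one_le_mul_of_one_le_of_one_le (h1 j) (h1' j)) (hβ j l)
    _ = ∏ j, M ^ d * (h j ^ (k * d) * h' j ^ (k * d)) := by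
        refine Finset.prod_congr rfl fun j _ => ?_
        rw [Finset.prod_const, Finset.card_univ, Fintype.card_fin, mul_pow M, mul_pow (h j),
          mul_pow (h j ^ k), pow_mul, pow_mul]
    _ ≤ ∏ j, M ^ d * h j ^ (2 * k * d) := by
        rw [Finset.prod_mul_distrib, Finset.prod_mul_distrib, Finset.prod_mul_distrib,
          Finset.prod_pow _ (k * d) h', Finset.prod_pow _ (k * d) h,
          Finset.prod_pow _ (2 * k * d) h]
        have hP : 0 ≤ ∏ j, h j := Finset.prod_nonneg fun i _ => zero_le_one.trans (h1 i)
        have hP' : 0 ≤ ∏ j, h' j := Finset.prod_nonneg fun i _ => zero_le_one.trans (h1' i)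
        have : (∏ j, h' j) ≤ ∏ j, h j := prod_next_le h1
        rw [show 2 * k * d = k * d + k * d by ring, pow_add]
        gcongr
    _ = _ := rfl

/-- The Gaussian moments of order at most `k` in each variable, at increasing times in `[0, T]`,
are bounded by products of powers of the gaps, with a constant `K ^ n` for `n` times. -/
def MomentBound (d k : ℕ) (H T K : ℝ) : Prop :=
  1 ≤ K ∧ ∀ (n : ℕ) (θ t : ℝ), 0 ≤ θ → t ≤ T → ∀ s ∈ simplex n θ t,
    ∀ β : Fin n → Fin d → ℕ, (∀ j l, β j l ≤ k) →
    ∫⁻ v : Fin n → EuclideanSpace ℝ (Fin d), ENNReal.ofReal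
      ((∏ j, ∏ l, |v j l| ^ β j l) * Real.exp (-(covForm H s v / 2))) ≤
    ENNReal.ofReal (K ^ n * ∏ j, |gap θ s j| ^ (-(d * H * (2 * k + 1))))

/-- Bound for the Gaussian moments that occur in the second moment of `Λ`. One half of the
Gaussian weight goes into `prod_pow_mul_exp_le`, the integral of the other half is bounded by
`lintegral_exp_neg_gram_le`. -/
theorem exists_lintegral_moment_le (d k : ℕ) {H : ℝ} (T : ℝ) (hH : 0 < H) (hH' : H < 1 / 2) :
    ∃ K : ℝ, MomentBound d k H T K := by
  have hH1 : 0 < 1 - 2 * H := by linarith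
  -- gaps divided by `a` are at most `1`, as `inv_rpow_sep_le` requires
  set a := max 1 T
  have ha : 1 ≤ a := le_max_left _ _
  have hTa : T ≤ a := le_max_right _ _
  have ha0 : 0 < a := by linarith
  -- the constant of `local_nondeterminism`, divided by `4` since a quarter of the form is used
  set b := H * (1 - 2 * H) / 16 with hb
  have hb0 : 0 < b := by positivity
  set M := (k.factorial : ℝ) / b ^ k * Real.exp b with hM
  have hM0 : 0 < M := by positivity
  set K₀ := M ^ d * (Real.pi / b) ^ ((d : ℝ) / 2) * a ^ (d * H * (2 * k + 1)) with hK₀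
  have hK₀0 : 0 < K₀ := by positivity
  refine ⟨max 1 K₀, le_max_left _ _, ?_⟩
  intro n θ t hθ ht s hs β hβ
  have hs0 : ∀ i, 0 ≤ s i := fun i => hθ.trans (hs.1 i).1.le
  set A := ∏ j, (M ^ d * ((gap θ s j / a) ^ (-H)) ^ (2 * k * d)) with hA
  have hg := fun j => gap_pos hs j
  have hA0 : 0 ≤ A := Finset.prod_nonneg fun j _ => by have := hg j; positivity
  have hpt : ∀ v : Fin n → EuclideanSpace ℝ (Fin d), ENNReal.ofReal
      ((∏ j, ∏ l, |v j l| ^ β j l) * Real.exp (-(covForm H s v / 2))) ≤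
      ENNReal.ofReal A * ENNReal.ofReal
        (Real.exp (-∑ l, ‖∑ i, v i l • ((1 / 2 : ℝ) • fbmVec H (s i))‖ ^ 2)) := by
    intro v
    rw [← ENNReal.ofReal_mul hA0]
    refine ENNReal.ofReal_le_ofReal ?_
    have e1 : ∑ l, ‖∑ i, v i l • ((1 / 2 : ℝ) • fbmVec H (s i))‖ ^ 2 = covForm H s v / 4 := by
      rw [covForm_eq hH hH' hs0, Finset.sum_div]
      refine Finset.sum_congr rfl fun l _ => ?_
      simp_rw [smul_comm _ (1 / 2 : ℝ)]
      rw [← Finset.smul_sum, norm_smul, mul_pow]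
      norm_num
      ring
    rw [e1, show -(covForm H s v / 2) = -(covForm H s v / 4) + -(covForm H s v / 4) by ring,
      Real.exp_add, ← mul_assoc]
    exact mul_le_mul_of_nonneg_right (prod_pow_mul_exp_le hH hH' hθ ht hTa ha hs hβ v)
      (Real.exp_pos _).le
  refine (lintegral_mono hpt).trans ?_
  rw [lintegral_const_mul' _ _ ENNReal.ofReal_ne_top]
  have hG := lintegral_exp_neg_gram_le d n (fun i => (1 / 2 : ℝ) • fbmVec H (s i))
    (fun j => b * gap θ s j ^ (2 * H)) (fun j => by have := hg j; positivity) (by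
      intro j w hw
      have := gap_rpow_mul_le hH hH' hθ hs j w hw
      simp_rw [smul_comm _ (1 / 2 : ℝ)]
      rw [← Finset.smul_sum, norm_smul, mul_pow]
      norm_num
      rw [hb]
      linarith)
  refine (mul_le_mul_right hG _).trans ?_
  rw [← ENNReal.ofReal_prod_of_nonneg (fun j _ => by have := hg j; positivity),
    ← ENNReal.ofReal_mul hA0]
  refine ENNReal.ofReal_le_ofReal ?_
  rw [hA, ← Finset.prod_mul_distrib]
  have hKn : (max 1 K₀) ^ n = ∏ _j : Fin n, max 1 K₀ := by simp
  rw [hKn, ← Finset.prod_mul_distrib]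
  refine Finset.prod_le_prod (fun j _ => by have := hg j; positivity) fun j _ => ?_
  have hgj := hg j
  rw [abs_of_pos hgj]
  have e2 : ((gap θ s j / a) ^ (-H)) ^ (2 * k * d) =
      a ^ (2 * k * d * H) * gap θ s j ^ (-(2 * k * d * H)) := by
    rw [← Real.rpow_natCast, ← Real.rpow_mul (by positivity), Real.div_rpow hgj.le ha0.le]
    push_cast
    rw [show -H * (2 * k * d) = -(2 * k * d * H) by ring, Real.rpow_neg ha0.le, div_inv_eq_mul,
      mul_comm]
  have e3 : (Real.pi / (b * gap θ s j ^ (2 * H))) ^ ((d : ℝ) / 2) =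
      (Real.pi / b) ^ ((d : ℝ) / 2) * gap θ s j ^ (-(d * H)) := by
    rw [← div_div, div_eq_mul_inv _ (gap θ s j ^ (2 * H)), Real.mul_rpow (by positivity)
      (by positivity), ← Real.rpow_neg hgj.le, ← Real.rpow_mul hgj.le]
    congr 2
    ring
  have e4 : gap θ s j ^ (-(d * H * (2 * k + 1))) =
      gap θ s j ^ (-(2 * k * d * H)) * gap θ s j ^ (-(d * H)) := by
    rw [← Real.rpow_add hgj]; congr 1; ring
  have e5 : a ^ (2 * k * d * H) ≤ a ^ (d * H * (2 * k + 1)) :=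
    Real.rpow_le_rpow_of_exponent_le ha (by
      nlinarith [mul_nonneg (Nat.cast_nonneg (α := ℝ) d) hH.le])
  rw [e2, e3, e4]
  have hG1 : 0 < gap θ s j ^ (-(2 * k * d * H)) := by positivity
  have hG2 : 0 < gap θ s j ^ (-(d * H)) := by positivity
  have hfin : M ^ d * a ^ (2 * k * d * H) * (Real.pi / b) ^ ((d : ℝ) / 2) ≤ max 1 K₀ := by
    refine le_trans ?_ (le_max_right _ _)
    rw [hK₀]
    calc _ = M ^ d * (Real.pi / b) ^ ((d : ℝ) / 2) * a ^ (2 * k * d * H) := by ring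
      _ ≤ _ := by gcongr
  calc _ = (M ^ d * a ^ (2 * k * d * H) * (Real.pi / b) ^ ((d : ℝ) / 2)) *
        (gap θ s j ^ (-(2 * k * d * H)) * gap θ s j ^ (-(d * H))) := by ring
    _ ≤ _ := by gcongr

/-! ### Integrals over simplices and shuffles -/

lemma lintegral_comp_perm {ι E : Type*} [Fintype ι] [MeasureSpace E]
    [SigmaFinite (volume : Measure E)] (σ : Equiv.Perm ι) (f : (ι → E) → ℝ≥0∞) :
    ∫⁻ v : ι → E, f (v ∘ σ) = ∫⁻ v, f v := by
  have h := volume_measurePreserving_piCongrLeft (fun _ : ι => E) σ.symm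
  rw [← h.lintegral_comp_emb (MeasurableEquiv.measurableEmbedding _) f]
  refine lintegral_congr fun v => congrArg f ?_
  ext i
  have := Equiv.piCongrLeft_apply_apply (fun _ : ι => E) σ.symm v (σ i)
  rw [Equiv.symm_apply_apply] at this
  exact this.symm

lemma lintegral_append {m n : ℕ} {E : Type*} [MeasureSpace E]
    [SigmaFinite (volume : Measure E)] {f : (Fin (m + n) → E) → ℝ≥0∞} (hf : Measurable f) :
    ∫⁻ v, f v = ∫⁻ u : Fin m → E, ∫⁻ w : Fin n → E, f (Fin.append u w) := by
  have h1 := volume_measurePreserving_piCongrLeft (fun _ : Fin (m + n) => E) finSumFinEquiv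
  have h2 := volume_measurePreserving_sumPiEquivProdPi_symm (fun _ : Fin m ⊕ Fin n => E)
  have h := h1.comp h2
  have e : ∀ p : (Fin m → E) × (Fin n → E),
      (MeasurableEquiv.piCongrLeft (fun _ : Fin (m + n) => E) finSumFinEquiv ∘
        (MeasurableEquiv.sumPiEquivProdPi fun _ : Fin m ⊕ Fin n => E).symm) p =
      Fin.append p.1 p.2 := by
    intro p
    ext i
    refine Fin.addCases (fun j => ?_) (fun j => ?_) i
    · rw [Fin.append_left, ← finSumFinEquiv_apply_left]
      exact Equiv.piCongrLeft_apply_apply (fun _ : Fin (m + n) => E) finSumFinEquiv _ (Sum.inl j)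
    · rw [Fin.append_right, ← finSumFinEquiv_apply_right]
      exact Equiv.piCongrLeft_apply_apply (fun _ : Fin (m + n) => E) finSumFinEquiv _ (Sum.inr j)
  rw [← h.lintegral_comp hf, Measure.volume_eq_prod,
    lintegral_prod]
  · simp_rw [e]
  · exact (hf.comp h.measurable).aemeasurable

/-- Almost every vector has distinct entries, as coinciding entries define hyperplanes. -/
lemma ae_injective (n : ℕ) : ∀ᵐ x : Fin n → ℝ, Function.Injective x := by
  have h : ∀ i j : Fin n, i ≠ j → ∀ᵐ x : Fin n → ℝ, x i ≠ x j := by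
    intro i j hij
    have h0 := Measure.addHaar_submodule (volume : Measure (Fin n → ℝ))
      (LinearMap.ker (LinearMap.proj (R := ℝ) (φ := fun _ : Fin n => ℝ) i - LinearMap.proj j)) (by
        intro h
        have : (Pi.single i 1 : Fin n → ℝ) ∈ LinearMap.ker
            (LinearMap.proj (R := ℝ) (φ := fun _ : Fin n => ℝ) i - LinearMap.proj j) := by
          rw [h]; trivial
        simp [Pi.single_eq_of_ne (Ne.symm hij)] at this)
    rw [ae_iff]
    convert h0 using 2
    ext x
    simp [sub_eq_zero]
  have h' : ∀ᵐ x : Fin n → ℝ, ∀ i j, i ≠ j → x i ≠ x j := by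
    rw [ae_all_iff]; intro i
    rw [ae_all_iff]; intro j
    by_cases hij : i = j
    · simp [hij]
    · simpa [hij] using h i j hij
  filter_upwards [h'] with x hx i j hij
  by_contra hne
  exact hx i j hne hij

/-- The vectors of `2m` times whose two halves both lie in the simplex. -/
def simplexPairs (m : ℕ) (θ t : ℝ) : Set (Fin (m + m) → ℝ) :=
  {x | (fun j => x (Fin.castAdd m j)) ∈ simplex m θ t ∧
    (fun j => x (Fin.natAdd m j)) ∈ simplex m θ t}

lemma append_mem_simplexPairs {m : ℕ} {θ t : ℝ} {s s' : Fin m → ℝ} :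
    Fin.append s s' ∈ simplexPairs m θ t ↔ s ∈ simplex m θ t ∧ s' ∈ simplex m θ t := by
  simp only [simplexPairs, Set.mem_ofPred_eq, Fin.append_left, Fin.append_right]

lemma measurable_comp_right {ι κ E : Type*} [MeasurableSpace E] (e : κ → ι) :
    Measurable fun x : ι → E => x ∘ e :=
  measurable_pi_lambda _ fun j => measurable_pi_apply (e j)

lemma measurableSet_simplexPairs (m : ℕ) (θ t : ℝ) : MeasurableSet (simplexPairs m θ t) :=
  (measurable_comp_right (Fin.castAdd m) (measurableSet_simplex m θ t)).inter
    (measurable_comp_right (Fin.natAdd m) (measurableSet_simplex m θ t))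

lemma setLIntegral_simplexPairs {m : ℕ} {θ t : ℝ} {f : (Fin (m + m) → ℝ) → ℝ≥0∞}
    (hf : Measurable f) :
    ∫⁻ x in simplexPairs m θ t, f x =
      ∫⁻ s in simplex m θ t, ∫⁻ s' in simplex m θ t, f (Fin.append s s') := by
  rw [← lintegral_indicator (measurableSet_simplexPairs m θ t),
    lintegral_append (hf.indicator (measurableSet_simplexPairs m θ t)),
    ← lintegral_indicator (measurableSet_simplex m θ t)]
  refine lintegral_congr fun s => ?_
  by_cases hs : s ∈ simplex m θ t
  · rw [Set.indicator_of_mem hs, ← lintegral_indicator (measurableSet_simplex m θ t)]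
    refine lintegral_congr fun s' => ?_
    by_cases hs' : s' ∈ simplex m θ t
    · rw [Set.indicator_of_mem hs', Set.indicator_of_mem (append_mem_simplexPairs.mpr ⟨hs, hs'⟩)]
    · rw [Set.indicator_of_notMem hs', Set.indicator_of_notMem]
      exact fun h => hs' (append_mem_simplexPairs.mp h).2
  · rw [Set.indicator_of_notMem hs]
    refine lintegral_eq_zero_of_ae_eq_zero (Eventually.of_forall fun s' => ?_)
    exact Set.indicator_of_notMem (fun h => hs (append_mem_simplexPairs.mp h).1) _

/-- Two increasing vectors of times are merged into one: almost every pair in the product of two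
simplices comes from a point of the larger simplex by a shuffle. -/
theorem setLIntegral_simplexPairs_le {m : ℕ} {θ t : ℝ} {f : (Fin (m + m) → ℝ) → ℝ≥0∞}
    (hf : Measurable f) :
    ∫⁻ x in simplexPairs m θ t, f x ≤
      ∑ σ ∈ shuffles m m, ∫⁻ r in simplex (m + m) θ t, f (r ∘ σ) := by
  have h1 : ∀ σ : Equiv.Perm (Fin (m + m)), ∫⁻ r in simplex (m + m) θ t, f (r ∘ σ) =
      ∫⁻ x, ((fun x => x ∘ σ.symm) ⁻¹' simplex (m + m) θ t).indicator f x := by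
    intro σ
    rw [← lintegral_indicator (measurableSet_simplex _ θ t), ← lintegral_comp_perm σ
      (((fun x => x ∘ σ.symm) ⁻¹' simplex (m + m) θ t).indicator f)]
    refine lintegral_congr fun r => ?_
    have : (r ∘ σ) ∘ σ.symm = r := by ext; simp
    by_cases hr : r ∈ simplex (m + m) θ t
    · rw [Set.indicator_of_mem hr, Set.indicator_of_mem]
      rwa [Set.mem_preimage, this]
    · rw [Set.indicator_of_notMem hr, Set.indicator_of_notMem]
      rwa [Set.mem_preimage, this]
  have hm : ∀ σ : Equiv.Perm (Fin (m + m)),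
      MeasurableSet ((fun x : Fin (m + m) → ℝ => x ∘ σ.symm) ⁻¹' simplex (m + m) θ t) := fun σ =>
    measurable_comp_right σ.symm (measurableSet_simplex _ θ t)
  simp_rw [h1]
  rw [← lintegral_finsetSum _ fun σ _ => hf.indicator (hm σ),
    ← lintegral_indicator (measurableSet_simplexPairs m θ t)]
  refine lintegral_mono_ae ?_
  filter_upwards [ae_injective (m + m)] with x hx
  by_cases hxm : x ∈ simplexPairs m θ t
  · rw [Set.indicator_of_mem hxm]
    -- the shuffle sends each index to the rank of its time
    set σ : Equiv.Perm (Fin (m + m)) := (Tuple.sort x).symm with hσ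
    have hmono : StrictMono (x ∘ Tuple.sort x) :=
      (Tuple.monotone_sort x).strictMono_of_injective (hx.comp (Equiv.injective _))
    have hcomp : ∀ i, x i = (x ∘ Tuple.sort x) (σ i) := fun i => by simp [hσ]
    have hσm : σ ∈ shuffles m m := by
      simp only [shuffles, Finset.mem_filter, Finset.mem_univ, true_and]
      constructor
      · intro i j hij
        have := hxm.1.2 hij
        simp only [hcomp] at this
        exact hmono.lt_iff_lt.mp this
      · intro i j hij
        have := hxm.2.2 hij
        simp only [hcomp] at this
        exact hmono.lt_iff_lt.mp this
    refine le_trans (le_of_eq ?_) (Finset.single_le_sum (fun _ _ => zero_le) hσm)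
    rw [Set.indicator_of_mem]
    refine ⟨fun j => ?_, hmono⟩
    have : ∀ i, θ < x i ∧ x i < t := fun i =>
      Fin.addCases (fun j => hxm.1.1 j) (fun j => hxm.2.1 j) i
    exact this _
  · rw [Set.indicator_of_notMem hxm]
    exact zero_le

lemma comp_mem_simplex {m n : ℕ} {θ t : ℝ} {r : Fin n → ℝ} (hr : r ∈ simplex n θ t)
    {e : Fin m → Fin n} (he : StrictMono e) : r ∘ e ∈ simplex m θ t :=
  ⟨fun j => hr.1 (e j), hr.2.comp he⟩

/-- Inserting further times shrinks the gaps. -/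
lemma gap_le_gap_comp {m n : ℕ} {θ t : ℝ} {r : Fin n → ℝ} (hr : r ∈ simplex n θ t)
    {e : Fin m → Fin n} (he : StrictMono e) (j : Fin m) : gap θ r (e j) ≤ gap θ (r ∘ e) j := by
  by_cases h : (j : ℕ) = 0
  · rw [gap.eq_def θ (r ∘ e), if_pos h]
    exact gap_le_sub_left hr _
  · rw [gap.eq_def θ (r ∘ e), if_neg h]
    refine gap_le_sub hr (he ?_)
    rw [Fin.lt_def]
    change (j : ℕ) - 1 < j
    omega

/-- The square of an integral over the simplex is bounded by `Ψ`, since the gaps shrink when two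
vectors of times are merged. -/
theorem sq_setLIntegral_simplex_le_Psi (d k : ℕ) {H : ℝ} (hH : 0 < H) {m : ℕ} {g : Fin m → ℝ → ℝ}
    (hg : ∀ j, Measurable (g j)) (θ t : ℝ) :
    (∫⁻ s in simplex m θ t, ENNReal.ofReal
      ((∏ j, |g j (s j)|) * ∏ j, |gap θ s j| ^ (-(d * H * (2 * k + 1))))) ^ 2 ≤
    Psi d k H g θ t := by
  set p := d * H * (2 * k + 1) with hp
  have hp0 : 0 ≤ p := by positivity
  set A : (Fin m → ℝ) → ℝ≥0∞ := fun s => ENNReal.ofReal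
    ((∏ j, |g j (s j)|) * ∏ j, |gap θ s j| ^ (-p)) with hA
  have hAm : Measurable A := by
    refine Measurable.ennreal_ofReal (Measurable.mul ?_ ?_)
    · exact Finset.measurable_prod _ fun j _ =>
        ((hg j).comp (measurable_pi_apply j)).abs
    · exact Finset.measurable_prod _ fun j _ => ((measurable_gap j).abs).pow_const _
  have hfm : Measurable fun x : Fin (m + m) → ℝ =>
      A (fun j => x (Fin.castAdd m j)) * A (fun j => x (Fin.natAdd m j)) :=
    (hAm.comp (measurable_pi_lambda _ fun j => measurable_pi_apply _)).mul
      (hAm.comp (measurable_pi_lambda _ fun j => measurable_pi_apply _))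
  have e : (∫⁻ s in simplex m θ t, A s) ^ 2 = ∫⁻ x in simplexPairs m θ t,
      A (fun j => x (Fin.castAdd m j)) * A (fun j => x (Fin.natAdd m j)) := by
    rw [setLIntegral_simplexPairs hfm, sq, ← lintegral_mul_const _ hAm]
    refine lintegral_congr fun s => ?_
    simp only [Fin.append_left, Fin.append_right]
    rw [lintegral_const_mul _ hAm]
  rw [e]
  refine (setLIntegral_simplexPairs_le hfm).trans ?_
  unfold Psi
  refine Finset.sum_le_sum fun σ hσ =>
    setLIntegral_mono' (measurableSet_simplex _ θ t) fun r hr => ?_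
  have hσ' : StrictMono (fun i : Fin m => σ (Fin.castAdd m i)) ∧
      StrictMono (fun i : Fin m => σ (Fin.natAdd m i)) := by
    simpa [shuffles] using hσ
  simp only [hA]
  rw [← ENNReal.ofReal_mul (by positivity)]
  refine ENNReal.ofReal_le_ofReal ?_
  have hgap : ∀ e : Fin m → Fin (m + m), StrictMono e →
      ∏ j, |gap θ (r ∘ e) j| ^ (-p) ≤ ∏ j, |gap θ r (e j)| ^ (-p) := by
    intro e he
    refine Finset.prod_le_prod (fun j _ => by positivity) fun j _ => ?_
    rw [abs_of_pos (gap_pos hr _), abs_of_pos (gap_pos (comp_mem_simplex hr he) _)]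
    exact Real.rpow_le_rpow_of_nonpos (gap_pos hr _) (gap_le_gap_comp hr he j) (by linarith)
  have h1 := hgap _ hσ'.1
  have h2 := hgap _ hσ'.2
  rw [← Equiv.prod_comp σ (fun i => |gap θ r i| ^ (-p)), Fin.prod_univ_add, Finset.prod_mul_distrib]
  calc _ = ((∏ j : Fin m, |g j ((r ∘ σ) (Fin.castAdd m j))|) *
        ∏ j : Fin m, |g j ((r ∘ σ) (Fin.natAdd m j))|) *
        ((∏ j, |gap θ (r ∘ fun i : Fin m => σ (Fin.castAdd m i)) j| ^ (-p)) *
        ∏ j, |gap θ (r ∘ fun i : Fin m => σ (Fin.natAdd m i)) j| ^ (-p)) := by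
        rw [mul_mul_mul_comm]; rfl
    _ ≤ _ := by
        exact mul_le_mul_of_nonneg_left (mul_le_mul h1 h2 (by positivity) (by positivity))
          (by positivity)

/-! ### Characteristic functions and moments of oscillatory integrals -/

/-- A version of fractional Brownian motion that is jointly measurable in time and chance, and
agrees with the given one at all times of `[0, T]` outside a null set. -/
lemma IsFBM.exists_measurable_version {Ω : Type*} [MeasurableSpace Ω] {P : Measure Ω} {d : ℕ}
    {H T : ℝ} {B : ℝ → Ω → EuclideanSpace ℝ (Fin d)} (hB : IsFBM P d H T B) (hT : 0 ≤ T) :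
    ∃ B' : ℝ → Ω → EuclideanSpace ℝ (Fin d), Measurable (Function.uncurry B') ∧
      ∀ᵐ ω ∂P, ∀ t ∈ Set.Icc 0 T, B' t ω = B t ω := by
  classical
  obtain ⟨N, hN, hNm, hN0⟩ := exists_measurable_superset_of_null (ae_iff.mp hB.continuous_paths)
  have hcont : ∀ ω ∉ N, ContinuousOn (fun t => B t ω) (Set.Icc 0 T) := by
    intro ω hω
    by_contra h
    exact hω (hN h)
  refine ⟨fun t ω => if ω ∈ N then 0 else B (Set.projIcc 0 T hT t) ω, ?_, ?_⟩
  · refine measurable_uncurry_of_continuous_of_measurable (fun ω => ?_) (fun t => ?_)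
    · by_cases h : ω ∈ N
      · simpa [h] using continuous_const
      · simp only [h, if_false]
        exact (continuousOn_iff_continuous_domRestrict.mp (hcont ω h)).comp continuous_projIcc
    · exact Measurable.ite hNm measurable_const (hB.measurable _ (Set.projIcc 0 T hT t).2)
  · have : ∀ᵐ ω ∂P, ω ∉ N := measure_eq_zero_iff_ae_notMem.mp hN0
    filter_upwards [this] with ω hω t ht
    simp [hω, Set.projIcc_of_mem hT ht]

section charFun

variable {Ω : Type*} [MeasurableSpace Ω] {P : Measure Ω} {d : ℕ} {H T : ℝ}
  {B : ℝ → Ω → EuclideanSpace ℝ (Fin d)}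

lemma IsFBM.memLp_coord (hB : IsFBM P d H T B) {t : ℝ} (ht : t ∈ Set.Icc 0 T) (l : Fin d) :
    MemLp (fun ω => B t ω l) 2 P :=
  ((hB.gaussian.hasGaussianLaw_eval ⟨t, ht⟩).map_fun (EuclideanSpace.proj l)).memLp_two

lemma IsFBM.hasGaussianLaw_sum [IsProbabilityMeasure P] (hB : IsFBM P d H T B) {ι : Type*}
    [Fintype ι] {s : ι → ℝ} (hs : ∀ i, s i ∈ Set.Icc 0 T) (v : ι → EuclideanSpace ℝ (Fin d)) :
    HasGaussianLaw (fun ω => ∑ i, ⟪v i, B (s i) ω⟫) P := by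
  have h1 := hB.gaussian.comp_right (fun i : ι => (⟨s i, hs i⟩ : Set.Icc (0 : ℝ) T))
  have h2 := h1.comp_left (fun i => innerSL ℝ (v i))
  exact h2.hasGaussianLaw_fun_sum (I := Finset.univ)

lemma IsFBM.integral_sum [IsProbabilityMeasure P] (hB : IsFBM P d H T B) {ι : Type*}
    [Fintype ι] {s : ι → ℝ} (hs : ∀ i, s i ∈ Set.Icc 0 T) (v : ι → EuclideanSpace ℝ (Fin d)) :
    ∫ ω, ∑ i, ⟪v i, B (s i) ω⟫ ∂P = 0 := by
  have h : ∀ i l, Integrable (fun ω => B (s i) ω l * v i l) P := fun i l =>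
    ((hB.memLp_coord (hs i) l).integrable one_le_two).mul_const _
  simp only [PiLp.inner_apply, RCLike.inner_apply, conj_trivial]
  rw [integral_finsetSum _ fun i _ => integrable_finsetSum _ fun l _ => h i l]
  refine Finset.sum_eq_zero fun i _ => ?_
  rw [integral_finsetSum _ fun l _ => h i l]
  refine Finset.sum_eq_zero fun l _ => ?_
  rw [integral_mul_const, hB.mean _ (hs i), zero_mul]

lemma IsFBM.integral_sq_sum [IsProbabilityMeasure P] (hB : IsFBM P d H T B) {ι : Type*}
    [Fintype ι] {s : ι → ℝ} (hs : ∀ i, s i ∈ Set.Icc 0 T) (v : ι → EuclideanSpace ℝ (Fin d)) :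
    ∫ ω, (∑ i, ⟪v i, B (s i) ω⟫) ^ 2 ∂P = covForm H s v := by
  have h : ∀ i l j l', Integrable
      (fun ω => (v i l * v j l') * (B (s i) ω l * B (s j) ω l')) P := fun i l j l' =>
    ((hB.memLp_coord (hs i) l).integrable_mul (hB.memLp_coord (hs j) l')).const_mul _
  have e : ∀ ω, (∑ i, ⟪v i, B (s i) ω⟫) ^ 2 = ∑ i, ∑ l, ∑ j, ∑ l',
      (v i l * v j l') * (B (s i) ω l * B (s j) ω l') := by
    intro ω
    simp only [PiLp.inner_apply, RCLike.inner_apply, conj_trivial]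
    rw [sq, Finset.sum_mul]
    refine Finset.sum_congr rfl fun i _ => ?_
    rw [Finset.sum_mul]
    refine Finset.sum_congr rfl fun l _ => ?_
    rw [Finset.mul_sum]
    refine Finset.sum_congr rfl fun j _ => ?_
    rw [Finset.mul_sum]
    refine Finset.sum_congr rfl fun l' _ => ?_
    ring
  simp_rw [e]
  rw [integral_finsetSum _ fun i _ => integrable_finsetSum _ fun l _ =>
    integrable_finsetSum _ fun j _ => integrable_finsetSum _ fun l' _ => h i l j l', covForm,
    Finset.sum_comm]
  refine Finset.sum_congr rfl fun i _ => ?_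
  rw [integral_finsetSum _ fun l _ =>
    integrable_finsetSum _ fun j _ => integrable_finsetSum _ fun l' _ => h i l j l']
  refine Finset.sum_congr rfl fun l _ => ?_
  rw [integral_finsetSum _ fun j _ => integrable_finsetSum _ fun l' _ => h i l j l']
  refine Finset.sum_congr rfl fun j _ => ?_
  rw [integral_finsetSum _ fun l' _ => h i l j l', Finset.sum_eq_single l]
  · rw [integral_const_mul, hB.cov _ (hs i) _ (hs j), if_pos rfl, fbmCov]
  · intro l' _ hl
    rw [integral_const_mul, hB.cov _ (hs i) _ (hs j), if_neg (Ne.symm hl), mul_zero]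
  · intro h; exact absurd (Finset.mem_univ _) h

/-- The finite-dimensional characteristic functions of fractional Brownian motion. -/
lemma IsFBM.integral_cexp [IsProbabilityMeasure P] (hB : IsFBM P d H T B) {ι : Type*}
    [Fintype ι] {s : ι → ℝ} (hs : ∀ i, s i ∈ Set.Icc 0 T) (v : ι → EuclideanSpace ℝ (Fin d)) :
    ∫ ω, Complex.exp (((∑ i, ⟪v i, B (s i) ω⟫ : ℝ) : ℂ) * Complex.I) ∂P =
      Complex.exp (-(covForm H s v / 2 : ℝ)) := by
  have hG := hB.hasGaussianLaw_sum hs v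
  have h := hG.charFun_map_eq 1
  have hvar : Var[fun ω => ∑ i, ⟪v i, B (s i) ω⟫; P] = covForm H s v := by
    rw [variance_of_integral_eq_zero hG.aemeasurable (hB.integral_sum hs v),
      hB.integral_sq_sum hs v]
  have hi : ∀ y : ℝ, ⟪(1 : ℝ), y⟫ = y := fun y => by simp
  simp_rw [hi] at h
  rw [hvar, hB.integral_sum hs v, charFun_apply_real,
    integral_map hG.aemeasurable (by fun_prop)] at h
  simpa using h

lemma IsFBM.enorm_integral_cexp [IsProbabilityMeasure P] (hB : IsFBM P d H T B) {ι : Type*}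
    [Fintype ι] {s : ι → ℝ} (hs : ∀ i, s i ∈ Set.Icc 0 T) (v : ι → EuclideanSpace ℝ (Fin d)) :
    ‖∫ ω, Complex.exp (((∑ i, ⟪v i, B (s i) ω⟫ : ℝ) : ℂ) * Complex.I) ∂P‖ₑ =
      ENNReal.ofReal (Real.exp (-(covForm H s v / 2))) := by
  rw [hB.integral_cexp hs v, ← ofReal_norm, Complex.norm_exp]
  simp

end charFun

section moments

variable {X Ω : Type*} [MeasurableSpace X] [MeasurableSpace Ω] {ν : Measure X}
  {P : Measure Ω} [IsFiniteMeasure P] {a : X → ℂ} {e : X → Ω → ℂ}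

lemma integrable_mul_phase (ha : Integrable a ν) (he : Measurable (Function.uncurry e))
    (he1 : ∀ x ω, ‖e x ω‖ ≤ 1) : Integrable (fun p : X × Ω => a p.1 * e p.1 p.2) (ν.prod P) := by
  have h1 : Integrable (fun p : X × Ω => a p.1) (ν.prod P) := ha.comp_fst P
  exact h1.mul_bdd (c := 1) he.aestronglyMeasurable (Eventually.of_forall fun p => he1 _ _)

lemma enorm_integral_integral_le [SFinite ν] (ha : Integrable a ν)
    (he : Measurable (Function.uncurry e)) (he1 : ∀ x ω, ‖e x ω‖ ≤ 1) :
    ‖∫ ω, ∫ x, a x * e x ω ∂ν ∂P‖ₑ ≤ ∫⁻ x, ‖a x‖ₑ * ‖∫ ω, e x ω ∂P‖ₑ ∂ν := by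
  rw [integral_integral_swap (f := fun ω x => a x * e x ω) (integrable_mul_phase ha he he1).swap]
  refine (enorm_integral_le_lintegral_enorm _).trans (lintegral_mono fun x => ?_)
  rw [integral_const_mul, enorm_mul]

/-- Second moment of a random superposition of bounded phases: Fubini's theorem leaves the
expectations of the products of two phases. -/
lemma lintegral_enorm_sq_integral_le [SFinite ν] (ha : Integrable a ν)
    (he : Measurable (Function.uncurry e)) (he1 : ∀ x ω, ‖e x ω‖ ≤ 1) :
    ∫⁻ ω, ‖∫ x, a x * e x ω ∂ν‖ₑ ^ 2 ∂P ≤ ∫⁻ x, ∫⁻ x', ‖a x‖ₑ * ‖a x'‖ₑ *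
      ‖∫ ω, e x ω * (starRingEnd ℂ) (e x' ω) ∂P‖ₑ ∂ν ∂ν := by
  set S : Ω → ℂ := fun ω => ∫ x, a x * e x ω ∂ν with hS
  have ha' : Integrable (fun x => (starRingEnd ℂ) (a x)) ν :=
    (Complex.conjLIE.toContinuousLinearEquiv.toContinuousLinearMap).integrable_comp ha
  have hint2 : Integrable (fun p : X × X => a p.1 * (starRingEnd ℂ) (a p.2)) (ν.prod ν) :=
    ha.mul_prod ha'
  have hmeas2 : Measurable (Function.uncurry fun (p : X × X) ω => e p.1 ω *
      (starRingEnd ℂ) (e p.2 ω)) := by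
    refine (he.comp (measurable_fst.fst.prodMk measurable_snd)).mul ?_
    exact Complex.continuous_conj.measurable.comp
      (he.comp (measurable_fst.snd.prodMk measurable_snd))
  have hb2 : ∀ (p : X × X) ω, ‖e p.1 ω * (starRingEnd ℂ) (e p.2 ω)‖ ≤ 1 := by
    intro p ω
    rw [norm_mul, RCLike.norm_conj]
    exact mul_le_one₀ (he1 _ _) (norm_nonneg _) (he1 _ _)
  have hSS : ∀ ω, S ω * (starRingEnd ℂ) (S ω) = ∫ p : X × X, (a p.1 * (starRingEnd ℂ) (a p.2)) *
      (e p.1 ω * (starRingEnd ℂ) (e p.2 ω)) ∂(ν.prod ν) := by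
    intro ω
    rw [hS, ← integral_conj, ← integral_prod_mul]
    refine integral_congr_ae (Eventually.of_forall fun p => ?_)
    simp only [map_mul]
    ring
  have hkey : ∫⁻ ω, ‖S ω‖ₑ ^ 2 ∂P = ‖∫ ω, S ω * (starRingEnd ℂ) (S ω) ∂P‖ₑ := by
    have h1 : ∀ ω, S ω * (starRingEnd ℂ) (S ω) = ((‖S ω‖ ^ 2 : ℝ) : ℂ) := by
      intro ω
      rw [Complex.mul_conj, Complex.normSq_eq_norm_sq]
    have hi : Integrable (fun ω => ((‖S ω‖ ^ 2 : ℝ) : ℂ)) P := by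
      have := (integrable_mul_phase (P := P) hint2 hmeas2 hb2).integral_prod_right
      refine this.congr (Eventually.of_forall fun ω => ?_)
      change _ = ((‖S ω‖ ^ 2 : ℝ) : ℂ)
      rw [← h1, hSS]
    simp_rw [h1]
    rw [integral_complex_ofReal, ← ofReal_norm, Complex.norm_real,
      Real.norm_of_nonneg (by positivity), ofReal_integral_eq_lintegral_ofReal
        (show Integrable (fun ω => ‖S ω‖ ^ 2) P from hi.re)
      (Eventually.of_forall fun _ => by positivity)]
    refine lintegral_congr fun ω => ?_
    rw [ENNReal.ofReal_pow (norm_nonneg _), ofReal_norm]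
  rw [hkey]
  simp_rw [hSS]
  refine (enorm_integral_integral_le hint2 hmeas2 hb2).trans ?_
  refine (lintegral_prod_le _).trans (le_of_eq ?_)
  refine lintegral_congr fun x => lintegral_congr fun x' => ?_
  rw [enorm_mul, RCLike.enorm_conj]

end moments

/-! ### The dominating double integral -/

lemma measurable_append {X E : Type*} [MeasurableSpace X] [MeasurableSpace E] {m n : ℕ}
    {f : X → Fin m → E} {g : X → Fin n → E} (hf : Measurable f) (hg : Measurable g) :
    Measurable fun x => Fin.append (f x) (g x) := by
  refine measurable_pi_lambda _ fun i => ?_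
  refine Fin.addCases (fun j => ?_) (fun j => ?_) i
  · simp only [Fin.append_left]
    exact (measurable_pi_apply j).comp hf
  · simp only [Fin.append_right]
    exact (measurable_pi_apply j).comp hg

lemma lintegral_append_neg {m n d : ℕ}
    {f : (Fin (m + n) → EuclideanSpace ℝ (Fin d)) → ℝ≥0∞} (hf : Measurable f) :
    ∫⁻ u : Fin m → EuclideanSpace ℝ (Fin d), ∫⁻ u' : Fin n → EuclideanSpace ℝ (Fin d),
      f (Fin.append (-u) u') = ∫⁻ v, f v := by
  rw [lintegral_append hf]
  have : ∀ _ : Fin m, (volume : Measure (EuclideanSpace ℝ (Fin d))).IsNegInvariant :=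
    fun _ => inferInstance
  have : (volume : Measure (Fin m → EuclideanSpace ℝ (Fin d))).IsNegInvariant := inferInstance
  exact lintegral_neg_eq_self
    (fun u : Fin m → EuclideanSpace ℝ (Fin d) => ∫⁻ u', f (Fin.append u u'))

section pairMoment

variable {d m : ℕ}

/-- The weight whose integral over pairs of frequencies and times bounds the second moment
of `Λ`. -/
noncomputable def pairWeight (H : ℝ) (G : Fin m → ℝ → ℝ) (α : Fin m → Fin d → ℕ)
    (x : Fin (m + m) → ℝ) (v : Fin (m + m) → EuclideanSpace ℝ (Fin d)) : ℝ≥0∞ :=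
  ENNReal.ofReal ((∏ j : Fin m, |G j (x (Fin.castAdd m j))| * |G j (x (Fin.natAdd m j))|) *
    ((∏ i, ∏ l, |v i l| ^ (Fin.append α α i l)) * Real.exp (-(covForm H x v / 2))))

lemma measurable_covForm {ι : Type*} [Fintype ι] (H : ℝ) :
    Measurable fun p : (ι → ℝ) × (ι → EuclideanSpace ℝ (Fin d)) => covForm H p.1 p.2 := by
  unfold covForm fbmCov
  fun_prop

lemma measurable_pairWeight (H : ℝ) {G : Fin m → ℝ → ℝ} (hG : ∀ j, Measurable (G j))
    (α : Fin m → Fin d → ℕ) :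
    Measurable fun p : (Fin (m + m) → ℝ) × (Fin (m + m) → EuclideanSpace ℝ (Fin d)) =>
      pairWeight H G α p.1 p.2 := by
  unfold pairWeight
  have := measurable_covForm (d := d) (ι := Fin (m + m)) H
  have hG' : ∀ j i, Measurable fun p : (Fin (m + m) → ℝ) ×
      (Fin (m + m) → EuclideanSpace ℝ (Fin d)) => G j (p.1 i) := fun j i =>
    (hG j).comp ((measurable_pi_apply i).comp measurable_fst)
  refine Measurable.ennreal_ofReal (Measurable.mul ?_ (Measurable.mul ?_ ?_))
  · exact Finset.measurable_prod _ fun j _ => (hG' j _).abs.mul (hG' j _).abs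
  · fun_prop
  · fun_prop

/-- The integral of `pairWeight` over all pairs of times in the simplex and all pairs of
frequencies, the first of which lies in `A`. -/
noncomputable def pairMoment (H : ℝ) (G : Fin m → ℝ → ℝ) (α : Fin m → Fin d → ℕ) (θ t : ℝ)
    (A : Set (Fin m → EuclideanSpace ℝ (Fin d))) : ℝ≥0∞ :=
  ∫⁻ u in A, ∫⁻ s in simplex m θ t, ∫⁻ s' in simplex m θ t,
    ∫⁻ u', pairWeight H G α (Fin.append s s') (Fin.append (-u) u')

lemma measurable_pairWeight_append {X : Type*} [MeasurableSpace X] (H : ℝ) {G : Fin m → ℝ → ℝ}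
    (hG : ∀ j, Measurable (G j)) (α : Fin m → Fin d → ℕ) {s s' : X → Fin m → ℝ}
    {u u' : X → Fin m → EuclideanSpace ℝ (Fin d)} (hs : Measurable s) (hs' : Measurable s')
    (hu : Measurable u) (hu' : Measurable u') :
    Measurable fun x =>
      pairWeight H G α (Fin.append (s x) (s' x)) (Fin.append (-u x) (u' x)) := by
  have h : Measurable fun x => (Fin.append (s x) (s' x), Fin.append (-u x) (u' x)) :=
    (measurable_append hs hs').prodMk (measurable_append hu.neg hu')
  have := (measurable_pairWeight H hG α).comp h
  exact this

/-- The Gaussian moment bound for a pair of vectors of times that a shuffle merges into `r`. -/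
lemma lintegral_pairWeight_comp_le {k : ℕ} {H T K θ t : ℝ} (hθ : 0 ≤ θ) (ht : t ≤ T)
    (hK : MomentBound d k H T K) (G : Fin m → ℝ → ℝ) {α : Fin m → Fin d → ℕ} (hα : ∀ j l, α j l ≤ k)
    {r : Fin (m + m) → ℝ} (hr : r ∈ simplex (m + m) θ t) (σ : Equiv.Perm (Fin (m + m))) :
    ∫⁻ v, pairWeight H G α (r ∘ σ) v ≤ ENNReal.ofReal ((K ^ 2) ^ m) * ENNReal.ofReal
      ((∏ j : Fin m, |G j (r (σ (Fin.castAdd m j)))| * |G j (r (σ (Fin.natAdd m j)))|) *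
        ∏ i : Fin (m + m), |gap θ r i| ^ (-(d * H * (2 * k + 1)))) := by
  rw [← lintegral_comp_perm σ]
  have hβ : ∀ i l, Fin.append α α (σ.symm i) l ≤ k := by
    intro i l
    refine Fin.addCases (fun j => ?_) (fun j => ?_) (σ.symm i)
    · rw [Fin.append_left]; exact hα j l
    · rw [Fin.append_right]; exact hα j l
  set P := ∏ j : Fin m, |G j (r (σ (Fin.castAdd m j)))| * |G j (r (σ (Fin.natAdd m j)))| with hP
  have hP0 : 0 ≤ P := Finset.prod_nonneg fun j _ => by positivity
  have e : ∀ v : Fin (m + m) → EuclideanSpace ℝ (Fin d), pairWeight H G α (r ∘ σ) (v ∘ σ) =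
      ENNReal.ofReal P * ENNReal.ofReal
        ((∏ i, ∏ l, |v i l| ^ Fin.append α α (σ.symm i) l) * Real.exp (-(covForm H r v / 2))) := by
    intro v
    rw [← ENNReal.ofReal_mul hP0, pairWeight]
    have e1 : covForm H (r ∘ σ) (v ∘ σ) = covForm H r v := by
      unfold covForm
      refine Finset.sum_congr rfl fun l _ => ?_
      rw [← Equiv.sum_comp σ (fun i => ∑ j, v i l * v j l * fbmCov H (r i) (r j))]
      refine Finset.sum_congr rfl fun i _ => ?_
      rw [← Equiv.sum_comp σ (fun j => v (σ i) l * v j l * fbmCov H (r (σ i)) (r j))]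
      rfl
    have e2 : ∏ i, ∏ l, |(v ∘ σ) i l| ^ Fin.append α α i l =
        ∏ i, ∏ l, |v i l| ^ Fin.append α α (σ.symm i) l := by
      rw [← Equiv.prod_comp σ (fun i => ∏ l, |v i l| ^ Fin.append α α (σ.symm i) l)]
      simp
    rw [e1, e2]
    rfl
  simp_rw [e]
  rw [lintegral_const_mul' _ _ ENNReal.ofReal_ne_top]
  refine (mul_le_mul_right (hK.2 (m + m) θ t hθ ht r hr _ hβ) _).trans (le_of_eq ?_)
  rw [← ENNReal.ofReal_mul hP0, ← ENNReal.ofReal_mul (by positivity)]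
  congr 1
  rw [← pow_mul, two_mul]
  ring

/-- The second moment is bounded by `Ψ`: pairs of times are merged by shuffles, and the Gaussian
moment bound applies to the merged times. -/
theorem pairMoment_univ_le {k : ℕ} {H T K θ t : ℝ} (hθ : 0 ≤ θ) (ht : t ≤ T)
    (hK : MomentBound d k H T K) {G : Fin m → ℝ → ℝ} (hG : ∀ j, Measurable (G j))
    {α : Fin m → Fin d → ℕ} (hα : ∀ j l, α j l ≤ k) :
    pairMoment H G α θ t Set.univ ≤ ENNReal.ofReal ((K ^ 2) ^ m) * Psi d k H G θ t := by
  have hw := measurable_pairWeight H hG α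
  have hM : Measurable fun x => ∫⁻ v, pairWeight H G α x v := hw.lintegral_prod_right'
  have hinner : ∀ s s' : Fin m → ℝ,
      ∫⁻ u, ∫⁻ u', pairWeight H G α (Fin.append s s') (Fin.append (-u) u') =
        ∫⁻ v, pairWeight H G α (Fin.append s s') v := by
    intro s s'
    have hx : Measurable fun v => pairWeight H G α (Fin.append s s') v :=
      hw.of_uncurry_left (x := Fin.append s s')
    exact lintegral_append_neg hx
  have e : pairMoment H G α θ t Set.univ =
      ∫⁻ x in simplexPairs m θ t, ∫⁻ v, pairWeight H G α x v := by
    rw [setLIntegral_simplexPairs hM, pairMoment, Measure.restrict_univ]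
    have h1 : Measurable fun p : (((Fin m → EuclideanSpace ℝ (Fin d)) × (Fin m → ℝ)) ×
        (Fin m → ℝ)) × (Fin m → EuclideanSpace ℝ (Fin d)) => pairWeight H G α
          (Fin.append p.1.1.2 p.1.2) (Fin.append (-p.1.1.1) p.2) :=
      measurable_pairWeight_append H hG α (by fun_prop) (by fun_prop) (by fun_prop) (by fun_prop)
    have h2 := h1.lintegral_prod_right' (ν := volume)
    have h3 := h2.lintegral_prod_right' (ν := volume.restrict (simplex m θ t))
    rw [lintegral_lintegral_swap h3.aemeasurable]
    refine lintegral_congr fun s => ?_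
    have h4 : Measurable fun p : ((Fin m → EuclideanSpace ℝ (Fin d)) × (Fin m → ℝ)) ×
        (Fin m → EuclideanSpace ℝ (Fin d)) => pairWeight H G α
          (Fin.append s p.1.2) (Fin.append (-p.1.1) p.2) :=
      measurable_pairWeight_append H hG α measurable_const (by fun_prop) (by fun_prop)
        (by fun_prop)
    have h5 := h4.lintegral_prod_right' (ν := volume)
    rw [lintegral_lintegral_swap h5.aemeasurable]
    exact lintegral_congr fun s' => hinner s s'
  rw [e]
  refine (setLIntegral_simplexPairs_le hM).trans ?_
  rw [Psi, Finset.mul_sum]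
  refine Finset.sum_le_sum fun σ _ => ?_
  rw [← lintegral_const_mul' _ _ ENNReal.ofReal_ne_top]
  exact setLIntegral_mono' (measurableSet_simplex _ θ t) fun r hr =>
    lintegral_pairWeight_comp_le hθ ht hK G hα hr σ

lemma pairMoment_mono (H : ℝ) (G : Fin m → ℝ → ℝ) (α : Fin m → Fin d → ℕ) (θ t : ℝ)
    {A A' : Set (Fin m → EuclideanSpace ℝ (Fin d))} (h : A ⊆ A') :
    pairMoment H G α θ t A ≤ pairMoment H G α θ t A' :=
  lintegral_mono_set h

/-- The set of frequencies of Euclidean norm less than `R`. -/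
def freqBall (d m : ℕ) (R : ℝ) : Set (Fin m → EuclideanSpace ℝ (Fin d)) :=
  {u | ∑ j, ‖u j‖ ^ 2 < R ^ 2}

lemma measurableSet_freqBall (R : ℝ) : MeasurableSet (freqBall d m R) :=
  measurableSet_lt (by fun_prop) measurable_const

lemma isBounded_freqBall (R : ℝ) : Bornology.IsBounded (freqBall d m R) := by
  refine (Metric.isBounded_closedBall (x := 0) (r := |R|)).subset fun u hu => ?_
  rw [mem_closedBall_zero_iff, pi_norm_le_iff_of_nonneg (abs_nonneg _)]
  intro j
  have h1 : ‖u j‖ ^ 2 ≤ ∑ j, ‖u j‖ ^ 2 :=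
    Finset.single_le_sum (f := fun j => ‖u j‖ ^ 2) (fun _ _ => sq_nonneg _) (Finset.mem_univ j)
  have hu' : ∑ j, ‖u j‖ ^ 2 < R ^ 2 := hu
  exact abs_le_of_sq_le_sq' (by rw [sq_abs]; exact h1.trans hu'.le) (abs_nonneg R) |>.2

lemma freqBall_mono {R R' : ℝ} (hR : 0 ≤ R) (h : R ≤ R') : freqBall d m R ⊆ freqBall d m R' :=
  fun _ hu => lt_of_lt_of_le hu (pow_le_pow_left₀ hR h 2)

/-- The contribution of high frequencies vanishes. -/
lemma tendsto_pairMoment_compl (H : ℝ) {G : Fin m → ℝ → ℝ} (hG : ∀ j, Measurable (G j))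
    (α : Fin m → Fin d → ℕ) (θ t : ℝ) (hfin : pairMoment H G α θ t Set.univ ≠ ∞) :
    Tendsto (fun R => pairMoment H G α θ t (freqBall d m R)ᶜ) atTop (𝓝 0) := by
  have h1 : Measurable fun p : (((Fin m → EuclideanSpace ℝ (Fin d)) × (Fin m → ℝ)) ×
      (Fin m → ℝ)) × (Fin m → EuclideanSpace ℝ (Fin d)) => pairWeight H G α
        (Fin.append p.1.1.2 p.1.2) (Fin.append (-p.1.1.1) p.2) :=
    measurable_pairWeight_append H hG α (by fun_prop) (by fun_prop) (by fun_prop) (by fun_prop)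
  have hm := h1.lintegral_prod_right' (ν := volume)
  have hm2 := hm.lintegral_prod_right' (ν := volume.restrict (simplex m θ t))
  have hm3 := hm2.lintegral_prod_right' (ν := volume.restrict (simplex m θ t))
  set h : (Fin m → EuclideanSpace ℝ (Fin d)) → ℝ≥0∞ := fun u =>
    ∫⁻ s in simplex m θ t, ∫⁻ s' in simplex m θ t,
      ∫⁻ u', pairWeight H G α (Fin.append s s') (Fin.append (-u) u') with hh
  have hm4 : Measurable h := hm3
  have e : ∀ R, pairMoment H G α θ t (freqBall d m R)ᶜ =
      ∫⁻ u, (freqBall d m R)ᶜ.indicator h u := fun R => by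
    rw [lintegral_indicator (measurableSet_freqBall R).compl]
    rfl
  simp_rw [e]
  have h0 : ∫⁻ _u : Fin m → EuclideanSpace ℝ (Fin d), (0 : ℝ≥0∞) = 0 := by simp
  rw [← h0]
  refine tendsto_lintegral_filter_of_dominated_convergence h
    (Eventually.of_forall fun R => hm4.indicator (measurableSet_freqBall R).compl)
    (Eventually.of_forall fun R => Eventually.of_forall fun u => Set.indicator_le_self _ _ _) ?_
    (Eventually.of_forall fun u => ?_)
  · rw [pairMoment, Measure.restrict_univ] at hfin
    exact hfin
  · refine tendsto_const_nhds.congr' ?_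
    filter_upwards [eventually_gt_atTop (∑ j, ‖u j‖ ^ 2), eventually_ge_atTop 1] with R hR hR1
    rw [Set.indicator_of_notMem]
    rw [Set.mem_compl_iff, not_not]
    change ∑ j, ‖u j‖ ^ 2 < R ^ 2
    nlinarith

end pairMoment

/-! ### The Fourier integral over a bounded set of frequencies -/

/-- What the estimates use of fractional Brownian motion: joint measurability, and the modulus of
the finite-dimensional characteristic functions. -/
structure HasFBMCharFun {Ω : Type*} [MeasurableSpace Ω] (P : Measure Ω) {d : ℕ} (H T : ℝ)
    (B : ℝ → Ω → EuclideanSpace ℝ (Fin d)) : Prop where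
  measurable : Measurable (Function.uncurry B)
  enorm_charFun : ∀ (n : ℕ) (s : Fin n → ℝ), (∀ i, s i ∈ Set.Icc 0 T) →
    ∀ v : Fin n → EuclideanSpace ℝ (Fin d),
      ‖∫ ω, Complex.exp (((∑ i, ⟪v i, B (s i) ω⟫ : ℝ) : ℂ) * Complex.I) ∂P‖ₑ =
        ENNReal.ofReal (Real.exp (-(covForm H s v / 2)))

/-- The version of the process with the required joint measurability. -/
lemma IsFBM.exists_hasFBMCharFun {Ω : Type*} [MeasurableSpace Ω] {P : Measure Ω}
    [IsProbabilityMeasure P] {d : ℕ} {H T : ℝ} {B : ℝ → Ω → EuclideanSpace ℝ (Fin d)}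
    (hB : IsFBM P d H T B) (hT : 0 ≤ T) :
    ∃ B' : ℝ → Ω → EuclideanSpace ℝ (Fin d), HasFBMCharFun P H T B' ∧
      ∀ᵐ ω ∂P, ∀ t ∈ Set.Icc 0 T, B' t ω = B t ω := by
  obtain ⟨B', hm, hae⟩ := hB.exists_measurable_version hT
  refine ⟨B', ⟨hm, fun n s hs v => ?_⟩, hae⟩
  rw [← hB.enorm_integral_cexp hs v]
  congr 1
  refine integral_congr_ae ?_
  filter_upwards [hae] with ω hω
  simp only [hω _ (hs _)]

section lambdaOn

variable {Ω : Type*} {d m : ℕ}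

/-- The deterministic factor of the integrand of `Λ`. -/
noncomputable def coef (F : Fin m → ℝ → ℝ) (α : Fin m → Fin d → ℕ)
    (z : Fin m → EuclideanSpace ℝ (Fin d)) (p : (Fin m → EuclideanSpace ℝ (Fin d)) × (Fin m → ℝ)) :
    ℂ :=
  (∏ j, ((F j (p.2 j) : ℝ) : ℂ)) * ∏ j, (∏ l, (-Complex.I * ((p.1 j l : ℝ) : ℂ)) ^ (α j l)) *
    Complex.exp (((⟪p.1 j, z j⟫ : ℝ) : ℂ) * Complex.I)

/-- The random factor of the integrand of `Λ`, of modulus one. -/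
noncomputable def phase (B : ℝ → Ω → EuclideanSpace ℝ (Fin d))
    (p : (Fin m → EuclideanSpace ℝ (Fin d)) × (Fin m → ℝ)) (ω : Ω) : ℂ :=
  Complex.exp (((∑ j, ⟪-p.1 j, B (p.2 j) ω⟫ : ℝ) : ℂ) * Complex.I)

/-- The Fourier integral of `Λ`, with the frequency variable restricted to the set `A` and with
time weights `F j`. -/
noncomputable def lambdaOn (B : ℝ → Ω → EuclideanSpace ℝ (Fin d)) (F : Fin m → ℝ → ℝ)
    (α : Fin m → Fin d → ℕ) (θ t : ℝ) (z : Fin m → EuclideanSpace ℝ (Fin d))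
    (A : Set (Fin m → EuclideanSpace ℝ (Fin d))) (ω : Ω) : ℂ :=
  (((2 * Real.pi : ℝ) : ℂ) ^ (d * m))⁻¹ *
    ∫ u in A, ∫ s in simplex m θ t, coef F α z (u, s) * phase B (u, s) ω

lemma LambdaTrunc_eq_lambdaOn (B : ℝ → Ω → EuclideanSpace ℝ (Fin d))
    (f : Fin m → ℝ → EuclideanSpace ℝ (Fin d) → ℝ) (α : Fin m → Fin d → ℕ) (θ t : ℝ)
    (z : Fin m → EuclideanSpace ℝ (Fin d)) (R : ℝ) (ω : Ω) :
    LambdaTrunc B f α θ t z R ω =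
      lambdaOn B (fun j s => f j s (z j)) α θ t z (freqBall d m R) ω := by
  unfold LambdaTrunc lambdaOn freqBall
  congr 2
  refine funext fun u => ?_
  congr 1
  refine funext fun s => ?_
  simp only [coef, phase]
  rw [← Finset.prod_mul_distrib, Complex.ofReal_sum, Finset.sum_mul, Complex.exp_sum,
    ← Finset.prod_mul_distrib]
  refine Finset.prod_congr rfl fun j _ => ?_
  rw [mul_assoc, mul_assoc, mul_assoc, ← Complex.exp_add]
  congr 3
  rw [inner_sub_right, inner_neg_left]
  push_cast
  ring

lemma lambdaOn_congr {B B' : ℝ → Ω → EuclideanSpace ℝ (Fin d)} {F F' : Fin m → ℝ → ℝ}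
    (α : Fin m → Fin d → ℕ) {θ t T : ℝ} (hθ : 0 ≤ θ) (ht : t ≤ T)
    (z : Fin m → EuclideanSpace ℝ (Fin d)) (A : Set (Fin m → EuclideanSpace ℝ (Fin d))) {ω : Ω}
    (hB : ∀ t ∈ Set.Icc 0 T, B t ω = B' t ω)
    (hF : ∀ᵐ s : Fin m → ℝ, s ∈ simplex m θ t → ∀ j, F j (s j) = F' j (s j)) :
    lambdaOn B F α θ t z A ω = lambdaOn B' F' α θ t z A ω := by
  unfold lambdaOn
  congr 2
  refine funext fun u => ?_
  refine setIntegral_congr_ae (measurableSet_simplex m θ t) ?_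
  filter_upwards [hF] with s hs hsm
  have hI : ∀ j, s j ∈ Set.Icc 0 T := fun j =>
    ⟨hθ.trans (hsm.1 j).1.le, (hsm.1 j).2.le.trans ht⟩
  simp only [coef, phase, hs hsm, hB _ (hI _)]

lemma norm_coef (F : Fin m → ℝ → ℝ) (α : Fin m → Fin d → ℕ)
    (z : Fin m → EuclideanSpace ℝ (Fin d))
    (p : (Fin m → EuclideanSpace ℝ (Fin d)) × (Fin m → ℝ)) :
    ‖coef F α z p‖ = (∏ j, |F j (p.2 j)|) * ∏ j, ∏ l, |p.1 j l| ^ α j l := by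
  simp only [coef, norm_mul, norm_prod, Complex.norm_real, Real.norm_eq_abs, norm_pow, norm_neg,
    Complex.norm_I, one_mul, Complex.norm_exp_ofReal_mul_I, mul_one]

lemma norm_phase (B : ℝ → Ω → EuclideanSpace ℝ (Fin d))
    (p : (Fin m → EuclideanSpace ℝ (Fin d)) × (Fin m → ℝ)) (ω : Ω) : ‖phase B p ω‖ = 1 :=
  Complex.norm_exp_ofReal_mul_I _

lemma integrable_coef {F : Fin m → ℝ → ℝ} (hF : ∀ j, Integrable (F j)) (α : Fin m → Fin d → ℕ)
    (z : Fin m → EuclideanSpace ℝ (Fin d)) {A : Set (Fin m → EuclideanSpace ℝ (Fin d))}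
    (hA : Bornology.IsBounded A) (S : Set (Fin m → ℝ)) :
    Integrable (coef F α z) ((volume.restrict A).prod (volume.restrict S)) := by
  have h1 : Integrable (fun s : Fin m → ℝ => ∏ j, ((F j (s j) : ℝ) : ℂ)) :=
    Integrable.fintype_prod (f := fun j s => ((F j s : ℝ) : ℂ)) fun j => (hF j).ofReal
  have hc : Continuous fun u : Fin m → EuclideanSpace ℝ (Fin d) =>
      ∏ j, (∏ l, (-Complex.I * ((u j l : ℝ) : ℂ)) ^ (α j l)) *
        Complex.exp (((⟪u j, z j⟫ : ℝ) : ℂ) * Complex.I) := by fun_prop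
  have h2 : IntegrableOn (fun u : Fin m → EuclideanSpace ℝ (Fin d) =>
      ∏ j, (∏ l, (-Complex.I * ((u j l : ℝ) : ℂ)) ^ (α j l)) *
        Complex.exp (((⟪u j, z j⟫ : ℝ) : ℂ) * Complex.I)) A :=
    (hc.continuousOn.integrableOn_compact hA.isCompact_closure).mono_set subset_closure
  refine (h2.mul_prod h1.restrict).congr (Eventually.of_forall fun p => ?_)
  simp only [coef]
  ring

variable [MeasurableSpace Ω] {B : ℝ → Ω → EuclideanSpace ℝ (Fin d)}

lemma measurable_phase (hB : Measurable (Function.uncurry B)) :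
    Measurable (Function.uncurry (phase (m := m) B)) := by
  have h : ∀ j, Measurable fun q : ((Fin m → EuclideanSpace ℝ (Fin d)) × (Fin m → ℝ)) × Ω =>
      B (q.1.2 j) q.2 := fun j => by
    have hg : Measurable fun q : ((Fin m → EuclideanSpace ℝ (Fin d)) × (Fin m → ℝ)) × Ω =>
      (q.1.2 j, q.2) := by fun_prop
    exact hB.comp hg
  unfold phase Function.uncurry
  fun_prop

lemma integrable_coef_mul_phase (hB : Measurable (Function.uncurry B)) {F : Fin m → ℝ → ℝ}
    (hF : ∀ j, Integrable (F j)) (α : Fin m → Fin d → ℕ)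
    (z : Fin m → EuclideanSpace ℝ (Fin d)) {A : Set (Fin m → EuclideanSpace ℝ (Fin d))}
    (hA : Bornology.IsBounded A) (S : Set (Fin m → ℝ)) (ω : Ω) :
    Integrable (fun p => coef F α z p * phase B p ω)
      ((volume.restrict A).prod (volume.restrict S)) := by
  refine (integrable_coef hF α z hA S).mul_bdd (c := 1) ?_
    (Eventually.of_forall fun p => (norm_phase B p ω).le)
  exact ((measurable_phase hB).of_uncurry_right (y := ω)).aestronglyMeasurable

lemma lambdaOn_eq_integral_prod (hB : Measurable (Function.uncurry B)) {F : Fin m → ℝ → ℝ}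
    (hF : ∀ j, Integrable (F j)) (α : Fin m → Fin d → ℕ) (θ t : ℝ)
    (z : Fin m → EuclideanSpace ℝ (Fin d)) {A : Set (Fin m → EuclideanSpace ℝ (Fin d))}
    (hA : Bornology.IsBounded A) (ω : Ω) :
    lambdaOn B F α θ t z A ω = (((2 * Real.pi : ℝ) : ℂ) ^ (d * m))⁻¹ *
      ∫ p, coef F α z p * phase B p ω
        ∂((volume.restrict A).prod (volume.restrict (simplex m θ t))) := by
  rw [lambdaOn, integral_prod _ (integrable_coef_mul_phase hB hF α z hA _ ω)]

lemma lambdaOn_sub (hB : Measurable (Function.uncurry B)) {F : Fin m → ℝ → ℝ}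
    (hF : ∀ j, Integrable (F j)) (α : Fin m → Fin d → ℕ) (θ t : ℝ)
    (z : Fin m → EuclideanSpace ℝ (Fin d)) {A A' : Set (Fin m → EuclideanSpace ℝ (Fin d))}
    (hA : Bornology.IsBounded A') (hAA' : A ⊆ A') (hAm : MeasurableSet A) (ω : Ω) :
    lambdaOn B F α θ t z A' ω - lambdaOn B F α θ t z A ω = lambdaOn B F α θ t z (A' \ A) ω := by
  rw [lambdaOn, lambdaOn, lambdaOn, ← mul_sub, setIntegral_sdiff hAm _ hAA']
  exact (integrable_coef_mul_phase hB hF α z hA (simplex m θ t) ω).integral_prod_left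

lemma enorm_two_pi_pow_inv_le (n : ℕ) : ‖(((2 * Real.pi : ℝ) : ℂ) ^ n)⁻¹‖ₑ ≤ 1 := by
  rw [← ofReal_norm, norm_inv, norm_pow, Complex.norm_real, Real.norm_of_nonneg (by positivity)]
  refine ENNReal.ofReal_le_one.mpr (inv_le_one_of_one_le₀ (one_le_pow₀ ?_))
  linarith [Real.pi_gt_three]

variable {P : Measure Ω} {H T : ℝ}

lemma mem_Icc_of_mem_simplex {n : ℕ} {θ t : ℝ} (hθ : 0 ≤ θ) (ht : t ≤ T) {s : Fin n → ℝ}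
    (hs : s ∈ simplex n θ t) (j : Fin n) : s j ∈ Set.Icc 0 T :=
  ⟨hθ.trans (hs.1 j).1.le, (hs.1 j).2.le.trans ht⟩

lemma covForm_neg {ι : Type*} [Fintype ι] (s : ι → ℝ) (v : ι → EuclideanSpace ℝ (Fin d)) :
    covForm H s (-v) = covForm H s v := by
  simp [covForm]

/-- The expectation of a product of two phases is a characteristic function at the merged times; the
frequencies of the first factor change sign. -/
lemma enorm_mul_enorm_integral_phase_le (hB : HasFBMCharFun P H T B) {F G : Fin m → ℝ → ℝ}
    (hFG : ∀ j s, |F j s| ≤ |G j s|) (α : Fin m → Fin d → ℕ) (z : Fin m → EuclideanSpace ℝ (Fin d))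
    {p p' : (Fin m → EuclideanSpace ℝ (Fin d)) × (Fin m → ℝ)} (hp : ∀ j, p.2 j ∈ Set.Icc 0 T)
    (hp' : ∀ j, p'.2 j ∈ Set.Icc 0 T) :
    ‖coef F α z p‖ₑ * ‖coef F α z p'‖ₑ *
        ‖∫ ω, phase B p ω * (starRingEnd ℂ) (phase B p' ω) ∂P‖ₑ ≤
      pairWeight H G α (Fin.append p.2 p'.2) (Fin.append (-p.1) p'.1) := by
  have h1 : ∀ ω, phase B p ω * (starRingEnd ℂ) (phase B p' ω) =
      Complex.exp (((∑ i, ⟪Fin.append (-p.1) p'.1 i, B (Fin.append p.2 p'.2 i) ω⟫ : ℝ) : ℂ) *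
        Complex.I) := by
    intro ω
    rw [phase, phase, ← Complex.exp_conj, ← Complex.exp_add, Fin.sum_univ_add]
    simp only [Fin.append_left, Fin.append_right, map_mul, Complex.conj_I, Complex.conj_ofReal,
      inner_neg_left, Finset.sum_neg_distrib, Pi.neg_apply]
    congr 1
    push_cast
    ring
  have hmem : ∀ i, Fin.append p.2 p'.2 i ∈ Set.Icc 0 T := fun i => by
    refine Fin.addCases (fun j => ?_) (fun j => ?_) i
    · rw [Fin.append_left]; exact hp j
    · rw [Fin.append_right]; exact hp' j
  simp_rw [h1]
  rw [hB.enorm_charFun _ _ hmem, ← ofReal_norm, ← ofReal_norm, norm_coef, norm_coef,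
    ← ENNReal.ofReal_mul (by positivity), ← ENNReal.ofReal_mul (by positivity), pairWeight]
  refine ENNReal.ofReal_le_ofReal ?_
  rw [Fin.prod_univ_add]
  simp only [Fin.append_left, Fin.append_right, Pi.neg_apply, PiLp.neg_apply, abs_neg]
  rw [mul_mul_mul_comm, ← Finset.prod_mul_distrib, mul_assoc]
  refine mul_le_mul_of_nonneg_right ?_ (by positivity)
  exact Finset.prod_le_prod (fun j _ => by positivity) fun j _ =>
    mul_le_mul (hFG _ _) (hFG _ _) (abs_nonneg _) (abs_nonneg _)

/-- Second moment of the Fourier integral over the frequencies in `A`. -/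
theorem lintegral_enorm_lambdaOn_sq_le [IsProbabilityMeasure P] (hB : HasFBMCharFun P H T B)
    {F G : Fin m → ℝ → ℝ} (hF : ∀ j, Integrable (F j)) (hG : ∀ j, Measurable (G j))
    (hFG : ∀ j s, |F j s| ≤ |G j s|) (α : Fin m → Fin d → ℕ) {θ t : ℝ} (hθ : 0 ≤ θ) (ht : t ≤ T)
    (z : Fin m → EuclideanSpace ℝ (Fin d)) {A : Set (Fin m → EuclideanSpace ℝ (Fin d))}
    (hA : Bornology.IsBounded A) (hAm : MeasurableSet A) :
    ∫⁻ ω, ‖lambdaOn B F α θ t z A ω‖ₑ ^ 2 ∂P ≤ pairMoment H G α θ t A := by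
  set ν := (volume.restrict A).prod (volume.restrict (simplex m θ t)) with hν
  have hD := measurableSet_simplex m θ t
  have hνae : ∀ᵐ p ∂ν, ∀ j, p.2 j ∈ Set.Icc 0 T := by
    rw [hν, Measure.prod_restrict]
    filter_upwards [ae_restrict_mem (hAm.prod hD)] with p hp
    exact mem_Icc_of_mem_simplex hθ ht hp.2
  have h1 : Measurable fun q : ((Fin m → EuclideanSpace ℝ (Fin d)) × (Fin m → ℝ)) ×
      ((Fin m → EuclideanSpace ℝ (Fin d)) × (Fin m → ℝ)) =>
      pairWeight H G α (Fin.append q.1.2 q.2.2) (Fin.append (-q.1.1) q.2.1) :=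
    measurable_pairWeight_append H hG α (by fun_prop) (by fun_prop) (by fun_prop) (by fun_prop)
  calc ∫⁻ ω, ‖lambdaOn B F α θ t z A ω‖ₑ ^ 2 ∂P
      ≤ ∫⁻ ω, ‖∫ p, coef F α z p * phase B p ω ∂ν‖ₑ ^ 2 ∂P := by
        refine lintegral_mono fun ω => ?_
        rw [lambdaOn_eq_integral_prod hB.measurable hF α θ t z hA, enorm_mul]
        exact pow_le_pow_left' (mul_le_of_le_one_left' (enorm_two_pi_pow_inv_le _)) 2
    _ ≤ ∫⁻ p, ∫⁻ p', ‖coef F α z p‖ₑ * ‖coef F α z p'‖ₑ *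
          ‖∫ ω, phase B p ω * (starRingEnd ℂ) (phase B p' ω) ∂P‖ₑ ∂ν ∂ν :=
        lintegral_enorm_sq_integral_le (integrable_coef hF α z hA _)
          (measurable_phase hB.measurable) fun p ω => (norm_phase B p ω).le
    _ ≤ ∫⁻ p, ∫⁻ p', pairWeight H G α (Fin.append p.2 p'.2) (Fin.append (-p.1) p'.1) ∂ν ∂ν := by
        refine lintegral_mono_ae ?_
        filter_upwards [hνae] with p hp
        refine lintegral_mono_ae ?_
        filter_upwards [hνae] with p' hp'
        exact enorm_mul_enorm_integral_phase_le hB hFG α z hp hp'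
    _ = ∫⁻ u in A, ∫⁻ s in simplex m θ t,
          ∫⁻ p', pairWeight H G α (Fin.append s p'.2) (Fin.append (-u) p'.1) ∂ν := by
        rw [hν, lintegral_prod]
        exact h1.lintegral_prod_right'.aemeasurable
    _ ≤ _ := by
        rw [pairMoment]
        refine lintegral_mono fun u => lintegral_mono fun s => ?_
        rw [hν, lintegral_prod_symm]
        · exact lintegral_mono fun s' => setLIntegral_le_lintegral _ _
        · exact (measurable_pairWeight_append H hG α measurable_const measurable_snd
            measurable_const measurable_fst).aemeasurable

/-- First moment of the Fourier integral. -/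
theorem enorm_integral_lambdaOn_le [IsProbabilityMeasure P] (hB : HasFBMCharFun P H T B)
    {k : ℕ} {K : ℝ} (hK : MomentBound d k H T K) {F : Fin m → ℝ → ℝ}
    (hF : ∀ j, Integrable (F j)) (hFm : ∀ j, Measurable (F j))
    {α : Fin m → Fin d → ℕ} (hα : ∀ j l, α j l ≤ k) {θ t : ℝ} (hθ : 0 ≤ θ) (ht : t ≤ T)
    (z : Fin m → EuclideanSpace ℝ (Fin d)) {A : Set (Fin m → EuclideanSpace ℝ (Fin d))}
    (hA : Bornology.IsBounded A) :
    ‖∫ ω, lambdaOn B F α θ t z A ω ∂P‖ₑ ≤ ENNReal.ofReal (K ^ m) * ∫⁻ s in simplex m θ t,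
      ENNReal.ofReal ((∏ j, |F j (s j)|) * ∏ j, |gap θ s j| ^ (-(d * H * (2 * k + 1)))) := by
  set ν := (volume.restrict A).prod (volume.restrict (simplex m θ t)) with hν
  have hD := measurableSet_simplex m θ t
  have hcov := measurable_covForm (d := d) (ι := Fin m) H
  have hFm' : ∀ j, Measurable fun s : Fin m → ℝ => F j (s j) := fun j =>
    (hFm j).comp (measurable_pi_apply j)
  have hmeas : Measurable fun p : (Fin m → EuclideanSpace ℝ (Fin d)) × (Fin m → ℝ) =>
      ‖coef F α z p‖ₑ * ‖∫ ω, phase B p ω ∂P‖ₑ := by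
    have h1 : Measurable (coef F α z) := by
      unfold coef
      have : ∀ j, Measurable fun p : (Fin m → EuclideanSpace ℝ (Fin d)) × (Fin m → ℝ) =>
        F j (p.2 j) := fun j => (hFm' j).comp measurable_snd
      fun_prop
    have h2 : Measurable fun p => ∫ ω, phase (m := m) B p ω ∂P :=
      ((measurable_phase hB.measurable).stronglyMeasurable.integral_prod_right).measurable
    exact h1.enorm.mul h2.enorm
  simp_rw [lambdaOn_eq_integral_prod hB.measurable hF α θ t z hA]
  rw [integral_const_mul, enorm_mul]
  refine (mul_le_of_le_one_left' (enorm_two_pi_pow_inv_le _)).trans ?_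
  refine (enorm_integral_integral_le (integrable_coef hF α z hA _) (measurable_phase hB.measurable)
    fun p ω => (norm_phase B p ω).le).trans ?_
  rw [lintegral_prod_symm _ hmeas.aemeasurable, ← lintegral_const_mul' _ _ ENNReal.ofReal_ne_top]
  refine setLIntegral_mono' hD fun s hs => ?_
  have hP0 : 0 ≤ ∏ j, |F j (s j)| := Finset.prod_nonneg fun _ _ => abs_nonneg _
  have hK0 : 0 ≤ K := zero_le_one.trans hK.1
  calc ∫⁻ u in A, ‖coef F α z (u, s)‖ₑ * ‖∫ ω, phase B (u, s) ω ∂P‖ₑ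
      ≤ ∫⁻ u, ‖coef F α z (u, s)‖ₑ * ‖∫ ω, phase B (u, s) ω ∂P‖ₑ := setLIntegral_le_lintegral _ _
    _ = ∫⁻ u : Fin m → EuclideanSpace ℝ (Fin d), ENNReal.ofReal (∏ j, |F j (s j)|) *
          ENNReal.ofReal ((∏ j, ∏ l, |u j l| ^ α j l) * Real.exp (-(covForm H s u / 2))) := by
        refine lintegral_congr fun u => ?_
        have := hB.enorm_charFun m s (mem_Icc_of_mem_simplex hθ ht hs) (-u)
        rw [covForm_neg] at this
        simp only [Pi.neg_apply] at this
        simp only [phase]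
        rw [this, ← ofReal_norm, norm_coef, ← ENNReal.ofReal_mul (by positivity),
          ← ENNReal.ofReal_mul hP0, mul_assoc]
    _ ≤ ENNReal.ofReal (∏ j, |F j (s j)|) *
          ENNReal.ofReal (K ^ m * ∏ j, |gap θ s j| ^ (-(d * H * (2 * k + 1)))) := by
        rw [lintegral_const_mul' _ _ ENNReal.ofReal_ne_top]
        exact mul_le_mul_right (hK.2 m θ t hθ ht s hs α hα) _
    _ = _ := by
        rw [← ENNReal.ofReal_mul hP0, ← ENNReal.ofReal_mul (by positivity)]
        congr 1
        ring

end lambdaOn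

/-! ### Limits in mean square -/

lemma eLpNorm_two_sq {Ω E : Type*} [MeasurableSpace Ω] [NormedAddCommGroup E] (P : Measure Ω)
    (f : Ω → E) : eLpNorm f 2 P ^ 2 = ∫⁻ ω, ‖f ω‖ₑ ^ 2 ∂P := by
  have := eLpNorm_nnreal_pow_eq_lintegral (f := f) (μ := P) (p := 2) two_ne_zero
  simpa using this

lemma eLpNorm_two_le_iff {Ω E : Type*} [MeasurableSpace Ω] [NormedAddCommGroup E] {P : Measure Ω}
    {f : Ω → E} {b : ℝ≥0∞} : eLpNorm f 2 P ≤ b ↔ ∫⁻ ω, ‖f ω‖ₑ ^ 2 ∂P ≤ b ^ 2 := by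
  rw [← eLpNorm_two_sq, ENNReal.pow_le_pow_left_iff two_ne_zero]

lemma eLpNorm_two_le_rpow {Ω E : Type*} [MeasurableSpace Ω] [NormedAddCommGroup E] {P : Measure Ω}
    {f : Ω → E} {b : ℝ≥0∞} (h : ∫⁻ ω, ‖f ω‖ₑ ^ 2 ∂P ≤ b) :
    eLpNorm f 2 P ≤ b ^ (1 / 2 : ℝ) := by
  rw [eLpNorm_two_le_iff, ← ENNReal.rpow_natCast, ← ENNReal.rpow_mul]
  simpa using h

/-- A family of random fields that is Cauchy in `L²(Ω)`, uniformly in the parameter `z`, has a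
jointly measurable limit: for a sequence of indices along which the rate is geometric, there is
almost sure convergence for every `z`. -/
theorem exists_measurable_limit {Z Ω : Type*} [MeasurableSpace Z] [MeasurableSpace Ω]
    {P : Measure Ω} {X : ℝ → Z → Ω → ℂ} (hX : ∀ R, Measurable (Function.uncurry (X R)))
    {ε : ℝ → ℝ≥0∞} (hε : Tendsto ε atTop (𝓝 0))
    (hXε : ∀ z R R', 0 ≤ R → R ≤ R' → ∫⁻ ω, ‖X R' z ω - X R z ω‖ₑ ^ 2 ∂P ≤ ε R) :
    ∃ L : Z → Ω → ℂ, Measurable (Function.uncurry L) ∧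
      ∀ z R, 0 ≤ R → ∫⁻ ω, ‖X R z ω - L z ω‖ₑ ^ 2 ∂P ≤ ε R := by
  have hε' : Tendsto (fun n : ℕ => ε n) atTop (𝓝 0) := hε.comp tendsto_natCast_atTop_atTop
  -- along `φ` the rate `ε` is below `4 ^ (-n)`, so the `L²` distances are summable
  obtain ⟨φ, hφ, hεφ⟩ := extraction_forall_of_eventually
    (P := fun n k => ε (k : ℕ) < ((2 : ℝ≥0∞)⁻¹ ^ n) ^ 2) (fun n =>
      hε'.eventually_lt_const (by simp [pos_iff_ne_zero]))
  have hsymm : ∀ z R R', ∀ ω, ‖X R z ω - X R' z ω‖ₑ = ‖X R' z ω - X R z ω‖ₑ := fun z R R' ω => by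
    rw [← enorm_neg, neg_sub]
  have hXz : ∀ R z, Measurable (X R z) := fun R z => (hX R).of_uncurry_left
  refine ⟨fun z ω => limUnder atTop fun n => X (φ n) z ω, ?_, fun z R hR => ?_⟩
  · have := StronglyMeasurable.limUnder (l := atTop)
      (f := fun (n : ℕ) (p : Z × Ω) => Function.uncurry (X (φ n)) p)
      (fun n => (hX (φ n)).stronglyMeasurable)
    exact this.measurable
  · have hconv : ∀ᵐ ω ∂P, ∃ l : ℂ, Tendsto (fun n => X (φ n) z ω) atTop (𝓝 l) := by
      refine Lp.ae_tendsto_of_cauchy_eLpNorm (p := 2) (B := fun n => (2 : ℝ≥0∞)⁻¹ ^ n)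
        (fun n => (hXz _ z).aestronglyMeasurable) one_le_two ?_ ?_
      · rw [ENNReal.tsum_geometric]
        simp
      · intro N n n' hn hn'
        wlog hle : n ≤ n' generalizing n n'
        · have := this n' n hn' hn (le_of_not_ge hle)
          rwa [eLpNorm_sub_comm] at this
        rw [eLpNorm_sub_comm]
        refine lt_of_pow_lt_pow_left' 2 ?_
        rw [eLpNorm_two_sq]
        refine (hXε z (φ n) (φ n') (Nat.cast_nonneg _)
          (Nat.cast_le.mpr (hφ.monotone hle))).trans_lt ?_
        refine (hεφ n).trans_le (pow_le_pow_left' (pow_le_pow_right_of_le_one' ?_ hn) 2)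
        simp
    calc ∫⁻ ω, ‖X R z ω - limUnder atTop fun n => X (φ n) z ω‖ₑ ^ 2 ∂P
        = ∫⁻ ω, liminf (fun n => ‖X (φ n) z ω - X R z ω‖ₑ ^ 2) atTop ∂P := by
          refine lintegral_congr_ae ?_
          filter_upwards [hconv] with ω hω
          have h1 := tendsto_nhds_limUnder hω
          have h2 := ENNReal.Tendsto.pow (n := 2) (h1.sub_const (X R z ω)).enorm
          rw [h2.liminf_eq, ← enorm_neg, neg_sub]
      _ ≤ liminf (fun n => ∫⁻ ω, ‖X (φ n) z ω - X R z ω‖ₑ ^ 2 ∂P) atTop :=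
          lintegral_liminf_le fun n => (((hXz _ z).sub (hXz _ z)).enorm).pow_const 2
      _ ≤ ε R := by
          refine liminf_le_of_frequently_le' (Eventually.frequently ?_)
          have : Tendsto (fun n => ((φ n : ℕ) : ℝ)) atTop atTop :=
            tendsto_natCast_atTop_atTop.comp hφ.tendsto_atTop
          filter_upwards [this.eventually_ge_atTop R] with n hn
          exact hXε z R _ hR hn

section field

variable {Ω Z : Type*} {d m : ℕ} [MeasurableSpace Ω] [MeasurableSpace Z]
  {B : ℝ → Ω → EuclideanSpace ℝ (Fin d)} {P : Measure Ω} {H T : ℝ}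

lemma measurable_lambdaOn (hB : Measurable (Function.uncurry B)) {F : Z → Fin m → ℝ → ℝ}
    (hFm : ∀ j, Measurable fun q : Z × ℝ => F q.1 j q.2) (hF : ∀ z j, Integrable (F z j))
    (α : Fin m → Fin d → ℕ) (θ t : ℝ) {ζ : Z → Fin m → EuclideanSpace ℝ (Fin d)}
    (hζ : Measurable ζ) {A : Set (Fin m → EuclideanSpace ℝ (Fin d))} (hA : Bornology.IsBounded A) :
    Measurable (Function.uncurry fun z ω => lambdaOn B (F z) α θ t (ζ z) A ω) := by
  have h : Measurable fun q : (Z × Ω) × ((Fin m → EuclideanSpace ℝ (Fin d)) × (Fin m → ℝ)) =>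
      coef (F q.1.1) α (ζ q.1.1) q.2 * phase B q.2 q.1.2 := by
    refine Measurable.mul ?_ ?_
    · have h1 : ∀ j, Measurable fun q : (Z × Ω) × ((Fin m → EuclideanSpace ℝ (Fin d)) ×
          (Fin m → ℝ)) => F q.1.1 j (q.2.2 j) := fun j => by
        have hg : Measurable fun q : (Z × Ω) × ((Fin m → EuclideanSpace ℝ (Fin d)) ×
          (Fin m → ℝ)) => (q.1.1, q.2.2 j) := by fun_prop
        exact (hFm j).comp hg
      have h2 : ∀ j, Measurable fun q : (Z × Ω) × ((Fin m → EuclideanSpace ℝ (Fin d)) ×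
          (Fin m → ℝ)) => ζ q.1.1 j := fun j =>
        (measurable_pi_apply j).comp (hζ.comp measurable_fst.fst)
      unfold coef
      fun_prop
    · have hg : Measurable fun q : (Z × Ω) × ((Fin m → EuclideanSpace ℝ (Fin d)) ×
          (Fin m → ℝ)) => (q.2, q.1.2) := by fun_prop
      have := (measurable_phase (m := m) hB).comp hg
      exact this
  have h3 := (h.stronglyMeasurable.integral_prod_right'
    (ν := (volume.restrict A).prod (volume.restrict (simplex m θ t)))).measurable
  have e : (Function.uncurry fun z ω => lambdaOn B (F z) α θ t (ζ z) A ω) = fun q : Z × Ω =>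
      (((2 * Real.pi : ℝ) : ℂ) ^ (d * m))⁻¹ * ∫ p, coef (F q.1) α (ζ q.1) p * phase B p q.2
        ∂((volume.restrict A).prod (volume.restrict (simplex m θ t))) := by
    funext q
    exact lambdaOn_eq_integral_prod hB (hF q.1) α θ t (ζ q.1) hA q.2
  rw [e]
  exact h3.const_mul _

/-- Existence of `Λ` as a jointly measurable field. The weights `F z` are dominated by weights
`G` independent of `z`, so that the convergence of the Fourier integrals is uniform in `z`. -/
theorem exists_limit_lambdaOn [IsProbabilityMeasure P] (hB : HasFBMCharFun P H T B)
    {F : Z → Fin m → ℝ → ℝ} (hFm : ∀ j, Measurable fun q : Z × ℝ => F q.1 j q.2)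
    (hF : ∀ z j, Integrable (F z j)) {G : Fin m → ℝ → ℝ} (hG : ∀ j, Measurable (G j))
    (hFG : ∀ z j s, |F z j s| ≤ |G j s|) (α : Fin m → Fin d → ℕ) {θ t : ℝ} (hθ : 0 ≤ θ)
    (ht : t ≤ T) (hfin : pairMoment H G α θ t Set.univ ≠ ∞)
    {ζ : Z → Fin m → EuclideanSpace ℝ (Fin d)} (hζ : Measurable ζ) :
    ∃ L : Z → Ω → ℂ, Measurable (Function.uncurry L) ∧ ∀ z,
      (∀ R, MemLp (lambdaOn B (F z) α θ t (ζ z) (freqBall d m R)) 2 P) ∧ MemLp (L z) 2 P ∧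
      Tendsto (fun R => eLpNorm (fun ω => lambdaOn B (F z) α θ t (ζ z) (freqBall d m R) ω - L z ω)
        2 P) atTop (𝓝 0) := by
  have hXm : ∀ R, Measurable (Function.uncurry
      fun z ω => lambdaOn B (F z) α θ t (ζ z) (freqBall d m R) ω) := fun R =>
    measurable_lambdaOn hB.measurable hFm hF α θ t hζ (isBounded_freqBall R)
  have htail := tendsto_pairMoment_compl H hG α θ t hfin
  obtain ⟨L, hLm, hL⟩ := exists_measurable_limit (P := P) hXm htail (by
    intro z R R' hR hRR'
    simp_rw [lambdaOn_sub hB.measurable (hF z) α θ t (ζ z) (isBounded_freqBall R')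
      (freqBall_mono hR hRR') (measurableSet_freqBall R)]
    refine (lintegral_enorm_lambdaOn_sq_le hB (hF z) hG (hFG z) α hθ ht (ζ z)
      ((isBounded_freqBall R').subset Set.sdiff_subset)
      ((measurableSet_freqBall R').diff (measurableSet_freqBall R))).trans ?_
    exact pairMoment_mono H G α θ t fun u hu => hu.2)
  refine ⟨L, hLm, fun z => ?_⟩
  have hmem : ∀ R, MemLp (lambdaOn B (F z) α θ t (ζ z) (freqBall d m R)) 2 P := by
    intro R
    refine ⟨((hXm R).of_uncurry_left (x := z)).aestronglyMeasurable, ?_⟩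
    refine (eLpNorm_two_le_rpow ((lintegral_enorm_lambdaOn_sq_le hB (hF z) hG (hFG z) α hθ ht
      (ζ z) (isBounded_freqBall R) (measurableSet_freqBall R)).trans
      (pairMoment_mono H G α θ t (Set.subset_univ _)))).trans_lt ?_
    exact ENNReal.rpow_lt_top_of_nonneg (by norm_num) hfin
  have hdiff : Tendsto (fun R => eLpNorm (fun ω =>
      lambdaOn B (F z) α θ t (ζ z) (freqBall d m R) ω - L z ω) 2 P) atTop (𝓝 0) := by
    have h0 : Tendsto (fun R => pairMoment H G α θ t (freqBall d m R)ᶜ ^ (1 / 2 : ℝ)) atTop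
        (𝓝 0) := by
      have := htail.ennrpow_const (1 / 2 : ℝ)
      simpa using this
    refine tendsto_of_tendsto_of_tendsto_of_le_of_le' tendsto_const_nhds h0
      (Eventually.of_forall fun _ => zero_le) ?_
    filter_upwards [eventually_ge_atTop 0] with R hR
    exact eLpNorm_two_le_rpow (hL z R hR)
  refine ⟨hmem, ?_, hdiff⟩
  obtain ⟨R, hR⟩ := (hdiff.eventually_lt_const ENNReal.zero_lt_top).exists
  have hLz : Measurable (L z) := hLm.of_uncurry_left
  have h1 : MemLp (fun ω => lambdaOn B (F z) α θ t (ζ z) (freqBall d m R) ω - L z ω) 2 P :=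
    ⟨((hmem R).1.sub hLz.aestronglyMeasurable), hR⟩
  have h2 := (hmem R).sub h1
  have e : lambdaOn B (F z) α θ t (ζ z) (freqBall d m R) - (fun ω =>
      lambdaOn B (F z) α θ t (ζ z) (freqBall d m R) ω - L z ω) = L z := by
    ext ω; simp
  rwa [e] at h2

/-- A bound for the `L²` norms of the approximants passes to the limit. -/
lemma eLpNorm_limit_le {Ω : Type*} [MeasurableSpace Ω] {P : Measure Ω} {X : ℝ → Ω → ℂ} {L : Ω → ℂ}
    {b : ℝ≥0∞} (hX : ∀ R, MemLp (X R) 2 P) (hL : MemLp L 2 P)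
    (h : Tendsto (fun R => eLpNorm (fun ω => X R ω - L ω) 2 P) atTop (𝓝 0))
    (hb : ∀ R, eLpNorm (X R) 2 P ≤ b) : eLpNorm L 2 P ≤ b := by
  have h1 : Tendsto (fun R => b + eLpNorm (fun ω => X R ω - L ω) 2 P) atTop (𝓝 b) := by
    simpa using h.const_add b
  refine ge_of_tendsto h1 (Eventually.of_forall fun R => ?_)
  have e : L = X R - fun ω => X R ω - L ω := by ext ω; simp
  calc eLpNorm L 2 P = eLpNorm (X R - fun ω => X R ω - L ω) 2 P := by rw [← e]
    _ ≤ eLpNorm (X R) 2 P + eLpNorm (fun ω => X R ω - L ω) 2 P :=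
      eLpNorm_sub_le (hX R).1 ((hX R).1.sub hL.1) one_le_two
    _ ≤ _ := by gcongr; exact hb R

/-- A bound for the expectations of the approximants passes to the limit in `L²`. -/
lemma enorm_integral_limit_le {Ω : Type*} [MeasurableSpace Ω] {P : Measure Ω}
    [IsProbabilityMeasure P] {X : ℝ → Ω → ℂ} {L : Ω → ℂ}
    {b : ℝ≥0∞} (hX : ∀ R, MemLp (X R) 2 P) (hL : MemLp L 2 P)
    (h : Tendsto (fun R => eLpNorm (fun ω => X R ω - L ω) 2 P) atTop (𝓝 0))
    (hb : ∀ R, ‖∫ ω, X R ω ∂P‖ₑ ≤ b) : ‖∫ ω, L ω ∂P‖ₑ ≤ b := by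
  have h1 : Tendsto (fun R => b + eLpNorm (fun ω => X R ω - L ω) 2 P) atTop (𝓝 b) := by
    simpa using h.const_add b
  refine ge_of_tendsto h1 (Eventually.of_forall fun R => ?_)
  have iX := (hX R).integrable one_le_two
  have iL := hL.integrable one_le_two
  have e : ∫ ω, L ω ∂P = ∫ ω, X R ω ∂P - ∫ ω, (X R ω - L ω) ∂P := by
    rw [integral_sub iX iL]; ring
  rw [e]
  refine (enorm_sub_le).trans (add_le_add (hb R) ?_)
  refine (enorm_integral_le_lintegral_enorm _).trans ?_
  rw [← eLpNorm_one_eq_lintegral_enorm]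
  exact eLpNorm_le_eLpNorm_of_exponent_le one_le_two ((hX R).1.sub hL.1)

end field

/-! ### Time weights and the second moment bound -/

lemma lintegral_fin_prod {E : Type*} [MeasureSpace E] [SigmaFinite (volume : Measure E)] :
    ∀ {n : ℕ} {f : Fin n → E → ℝ≥0∞}, (∀ j, Measurable (f j)) →
      ∫⁻ z : Fin n → E, ∏ j, f j (z j) = ∏ j, ∫⁻ x, f j x := by
  intro n
  induction n with
  | zero =>
    intro f _
    rw [volume_pi, Measure.pi_of_empty]
    simp
  | succ n ih =>
    intro f hf
    have hm : Measurable fun z : Fin (n + 1) → E => ∏ j, f j (z j) :=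
      Finset.measurable_fun_prod _ fun j _ => (hf j).comp (measurable_pi_apply j)
    have hm' : Measurable fun z : Fin n → E => ∏ j, f j.succ (z j) :=
      Finset.measurable_fun_prod _ fun j _ => (hf j.succ).comp (measurable_pi_apply j)
    rw [lintegral_fin_succ _ hm, Fin.prod_univ_succ]
    simp_rw [Fin.prod_univ_succ, Fin.cons_zero, Fin.cons_succ]
    rw [← ih fun j => hf j.succ, ← lintegral_const_mul _ hm']
    exact lintegral_congr fun w => lintegral_mul_const _ (hf 0)

lemma ae_forall_coord {n : ℕ} {ι : Type*} [Countable ι] {p : ι → ℝ → Prop}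
    (h : ∀ j, ∀ᵐ s : ℝ, p j s) : ∀ᵐ r : Fin n → ℝ, ∀ i j, p j (r i) := by
  rw [ae_all_iff]; intro i
  rw [ae_all_iff]; intro j
  exact (Measure.tendsto_eval_ae_ae (μ := fun _ : Fin n => (volume : Measure ℝ))
    (i := i)).eventually (h j)

/-- Domination of the time weights almost everywhere in `[0, T]` passes to `Ψ`. -/
lemma Psi_le_of_abs_le (d k : ℕ) (H : ℝ) {T : ℝ} {m : ℕ} {g g' : Fin m → ℝ → ℝ} {M : ℝ}
    (hM : 0 ≤ M) {θ t : ℝ} (hθ : 0 ≤ θ) (ht : t ≤ T)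
    (h : ∀ j, ∀ᵐ s : ℝ, s ∈ Set.Icc 0 T → |g' j s| ≤ M * |g j s|) :
    Psi d k H g' θ t ≤ ENNReal.ofReal ((M ^ 2) ^ m) * Psi d k H g θ t := by
  unfold Psi
  rw [Finset.mul_sum]
  refine Finset.sum_le_sum fun σ _ => ?_
  rw [← lintegral_const_mul' _ _ ENNReal.ofReal_ne_top]
  refine setLIntegral_mono_ae' (measurableSet_simplex _ θ t) ?_
  filter_upwards [ae_forall_coord h] with r hr hrs
  have hI := mem_Icc_of_mem_simplex hθ ht hrs
  rw [← ENNReal.ofReal_mul (by positivity), ← mul_assoc]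
  refine ENNReal.ofReal_le_ofReal (mul_le_mul_of_nonneg_right ?_
    (Finset.prod_nonneg fun _ _ => by positivity))
  have e : (M ^ 2) ^ m = ∏ _j : Fin m, M ^ 2 := by simp
  rw [e, ← Finset.prod_mul_distrib]
  refine Finset.prod_le_prod (fun _ _ => by positivity) fun j _ => ?_
  calc _ ≤ (M * |g j (r (σ (Fin.castAdd m j)))|) * (M * |g j (r (σ (Fin.natAdd m j)))|) :=
        mul_le_mul (hr _ _ (hI _)) (hr _ _ (hI _)) (abs_nonneg _) (by positivity)
    _ = _ := by ring

lemma Psi_congr (d k : ℕ) (H : ℝ) {T : ℝ} {m : ℕ} {g g' : Fin m → ℝ → ℝ} {θ t : ℝ} (hθ : 0 ≤ θ)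
    (ht : t ≤ T) (h : ∀ j, ∀ᵐ s : ℝ, s ∈ Set.Icc 0 T → g' j s = g j s) :
    Psi d k H g' θ t = Psi d k H g θ t := by
  refine le_antisymm ?_ ?_
  · refine (Psi_le_of_abs_le d k H (g := g) zero_le_one hθ ht fun j => ?_).trans (by simp)
    filter_upwards [h j] with s hs hI
    rw [hs hI, one_mul]
  · refine (Psi_le_of_abs_le d k H (g := g') zero_le_one hθ ht fun j => ?_).trans (by simp)
    filter_upwards [h j] with s hs hI
    rw [hs hI, one_mul]

lemma Psi_eq_zero (d k : ℕ) (H : ℝ) {m : ℕ} {g : Fin m → ℝ → ℝ} {j : Fin m} (hj : ∀ s, g j s = 0)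
    (θ t : ℝ) : Psi d k H g θ t = 0 := by
  unfold Psi
  refine Finset.sum_eq_zero fun σ _ => ?_
  have : ∀ s : Fin (m + m) → ℝ,
      ∏ j : Fin m, |g j (s (σ (Fin.castAdd m j)))| * |g j (s (σ (Fin.natAdd m j)))| = 0 :=
    fun s => Finset.prod_eq_zero (Finset.mem_univ j) (by simp [hj])
  simp_rw [this, zero_mul, ENNReal.ofReal_zero]
  exact lintegral_zero

/-- The extension of `f` by zero outside of the times in `[0, T]`. -/
noncomputable def timeRestrict {d : ℕ} (T : ℝ) (f : ℝ → EuclideanSpace ℝ (Fin d) → ℝ) (s : ℝ)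
    (x : EuclideanSpace ℝ (Fin d)) : ℝ :=
  (Set.Icc 0 T ×ˢ (Set.univ : Set (EuclideanSpace ℝ (Fin d)))).indicator (Function.uncurry f) (s, x)

section timeRestrict

variable {d : ℕ} {T : ℝ} {f : ℝ → EuclideanSpace ℝ (Fin d) → ℝ}

lemma timeRestrict_of_mem {s : ℝ} (hs : s ∈ Set.Icc 0 T) (x : EuclideanSpace ℝ (Fin d)) :
    timeRestrict T f s x = f s x := by
  rw [timeRestrict, Set.indicator_of_mem (by simpa using hs)]
  rfl

lemma timeRestrict_of_notMem {s : ℝ} (hs : s ∉ Set.Icc 0 T) (x : EuclideanSpace ℝ (Fin d)) :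
    timeRestrict T f s x = 0 := by
  rw [timeRestrict, Set.indicator_of_notMem]
  exact fun h => hs h.1

lemma IsSmoothCompact.measurable (hf : IsSmoothCompact T f) :
    Measurable fun p : ℝ × EuclideanSpace ℝ (Fin d) => timeRestrict T f p.1 p.2 := by
  classical
  have h := hf.1.continuousOn.measurable_piecewise (g := fun _ => (0 : ℝ)) continuousOn_const
    (measurableSet_Icc.prod MeasurableSet.univ)
  have e : (fun p : ℝ × EuclideanSpace ℝ (Fin d) => timeRestrict T f p.1 p.2) =
      (Set.Icc 0 T ×ˢ Set.univ).piecewise (Function.uncurry f) fun _ => (0 : ℝ) := by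
    funext p
    by_cases hp : p ∈ Set.Icc 0 T ×ˢ (Set.univ : Set (EuclideanSpace ℝ (Fin d))) <;>
      simp only [timeRestrict, Set.indicator, Set.piecewise, hp, if_true, if_false]
  rw [e]
  exact h

lemma IsSmoothCompact.exists_bound (hf : IsSmoothCompact T f) :
    ∃ M : ℝ, 0 ≤ M ∧ ∀ s x, |timeRestrict T f s x| ≤ M := by
  obtain ⟨hc, K, hK, hK0⟩ := hf
  obtain ⟨M, hM⟩ := (isCompact_Icc.prod hK).exists_bound_of_continuousOn
    (hc.continuousOn.mono (Set.prod_mono_right (Set.subset_univ K)))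
  refine ⟨max M 0, le_max_right _ _, fun s x => ?_⟩
  by_cases hs : s ∈ Set.Icc 0 T
  · rw [timeRestrict_of_mem hs]
    by_cases hx : x ∈ K
    · exact (hM (s, x) ⟨hs, hx⟩).trans (le_max_left _ _)
    · rw [hK0 s hs x hx, abs_zero]
      exact le_max_right _ _
  · rw [timeRestrict_of_notMem hs, abs_zero]
    exact le_max_right _ _

lemma IsSmoothCompact.integrable (hf : IsSmoothCompact T f) (x : EuclideanSpace ℝ (Fin d)) :
    Integrable fun s => timeRestrict T f s x := by
  obtain ⟨M, _, hM⟩ := hf.exists_bound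
  have hm : Measurable fun s => timeRestrict T f s x := hf.measurable.comp measurable_prodMk_right
  have hi : IntegrableOn (fun s => timeRestrict T f s x) (Set.Icc 0 T) :=
    Measure.integrableOn_of_bounded (M := M) (by simp) hm.aestronglyMeasurable
      (Eventually.of_forall fun s => hM s x)
  refine (integrableOn_iff_integrable_of_support_subset fun s hs => ?_).mp hi
  by_contra h
  exact hs (timeRestrict_of_notMem h x)

end timeRestrict

section isLambda

variable {Ω : Type*} [MeasurableSpace Ω] {P : Measure Ω} {d m k : ℕ} {H T K : ℝ}
  {B B' : ℝ → Ω → EuclideanSpace ℝ (Fin d)}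

/-- Passage to the measurable version of the process and to other time weights. -/
lemma isLambda_iff (hBB' : ∀ᵐ ω ∂P, ∀ t ∈ Set.Icc 0 T, B' t ω = B t ω)
    {f : Fin m → ℝ → EuclideanSpace ℝ (Fin d) → ℝ} {F : Fin m → ℝ → ℝ} {α : Fin m → Fin d → ℕ}
    {θ t : ℝ} (hθ : 0 ≤ θ) (ht : t ≤ T) {z : Fin m → EuclideanSpace ℝ (Fin d)}
    (hF : ∀ j, ∀ᵐ s : ℝ, s ∈ Set.Icc 0 T → F j s = f j s (z j)) {L : Ω → ℂ} :
    IsLambda P B f α θ t z L ↔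
      (∀ R, MemLp (lambdaOn B' F α θ t z (freqBall d m R)) 2 P) ∧ MemLp L 2 P ∧
      Tendsto (fun R => eLpNorm (fun ω => lambdaOn B' F α θ t z (freqBall d m R) ω - L ω) 2 P)
        atTop (𝓝 0) := by
  have h : ∀ R, LambdaTrunc B f α θ t z R =ᵐ[P] lambdaOn B' F α θ t z (freqBall d m R) := by
    intro R
    filter_upwards [hBB'] with ω hω
    rw [LambdaTrunc_eq_lambdaOn]
    refine lambdaOn_congr α hθ ht z _ (fun t ht => (hω t ht).symm) ?_
    filter_upwards [ae_forall_coord hF] with s hs hsm j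
    exact (hs j j (mem_Icc_of_mem_simplex hθ ht hsm j)).symm
  have h1 : ∀ R, eLpNorm (fun ω => LambdaTrunc B f α θ t z R ω - L ω) 2 P =
      eLpNorm (fun ω => lambdaOn B' F α θ t z (freqBall d m R) ω - L ω) 2 P := fun R =>
    eLpNorm_congr_ae ((h R).mono fun ω hω => by simp only [hω])
  unfold IsLambda
  simp_rw [h1, memLp_congr_ae (h _)]

variable [IsProbabilityMeasure P]

/-- The second moment bound passes to the `L²` limit. -/
lemma eLpNorm_limit_lambdaOn_le (hB : HasFBMCharFun P H T B) (hK : MomentBound d k H T K)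
    {F : Fin m → ℝ → ℝ} (hF : ∀ j, Integrable (F j)) (hFm : ∀ j, Measurable (F j))
    {α : Fin m → Fin d → ℕ} (hα : ∀ j l, α j l ≤ k) {θ t : ℝ} (hθ : 0 ≤ θ) (ht : t ≤ T)
    {z : Fin m → EuclideanSpace ℝ (Fin d)} {L : Ω → ℂ}
    (hL : (∀ R, MemLp (lambdaOn B F α θ t z (freqBall d m R)) 2 P) ∧ MemLp L 2 P ∧
      Tendsto (fun R => eLpNorm (fun ω => lambdaOn B F α θ t z (freqBall d m R) ω - L ω) 2 P)
        atTop (𝓝 0)) :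
    eLpNorm L 2 P ≤ (ENNReal.ofReal ((K ^ 2) ^ m) * Psi d k H F θ t) ^ (1 / 2 : ℝ) := by
  refine eLpNorm_limit_le hL.1 hL.2.1 hL.2.2 fun R => eLpNorm_two_le_rpow ?_
  refine (lintegral_enorm_lambdaOn_sq_le hB hF hFm (fun _ _ => le_rfl) α hθ ht z
    (isBounded_freqBall R) (measurableSet_freqBall R)).trans ?_
  exact (pairMoment_mono H F α θ t (Set.subset_univ _)).trans
    (pairMoment_univ_le hθ ht hK hFm hα)

/-- Existence of `Λ` at a fixed point `z`, and its second moment. -/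
theorem exists_isLambda (hB : HasFBMCharFun P H T B')
    (hBB' : ∀ᵐ ω ∂P, ∀ t ∈ Set.Icc 0 T, B' t ω = B t ω) (hK : MomentBound d k H T K)
    {f : Fin m → ℝ → EuclideanSpace ℝ (Fin d) → ℝ} (hf : ∀ j, IsSmoothCompact T (f j))
    {α : Fin m → Fin d → ℕ} (hα : ∀ j l, α j l ≤ k) {θ t : ℝ} (hθ : 0 ≤ θ) (ht : t ≤ T)
    (z : Fin m → EuclideanSpace ℝ (Fin d)) (hΨ : Psi d k H (fun j s => f j s (z j)) θ t < ∞) :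
    (∃ L : Ω → ℂ, IsLambda P B f α θ t z L) ∧ ∀ L : Ω → ℂ, IsLambda P B f α θ t z L →
      ∫⁻ ω, ‖L ω‖ₑ ^ 2 ∂P ≤
        ENNReal.ofReal ((K ^ 2) ^ m) * Psi d k H (fun j s => f j s (z j)) θ t := by
  set F : Fin m → ℝ → ℝ := fun j s => timeRestrict T (f j) s (z j) with hFdef
  have hFm : ∀ j, Measurable (F j) := fun j => (hf j).measurable.comp measurable_prodMk_right
  have hF : ∀ j, Integrable (F j) := fun j => (hf j).integrable (z j)
  have hFf : ∀ j, ∀ᵐ s : ℝ, s ∈ Set.Icc 0 T → F j s = f j s (z j) := fun j =>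
    Eventually.of_forall fun s hs => timeRestrict_of_mem hs _
  have hΨeq : Psi d k H F θ t = Psi d k H (fun j s => f j s (z j)) θ t :=
    Psi_congr d k H hθ ht hFf
  rw [← hΨeq] at hΨ ⊢
  have hiff := fun L => isLambda_iff (L := L) (α := α) (z := z) hBB' hθ ht hFf
  have hfin : pairMoment H F α θ t Set.univ ≠ ∞ :=
    ((pairMoment_univ_le hθ ht hK hFm hα).trans_lt
      (ENNReal.mul_lt_top ENNReal.ofReal_lt_top hΨ)).ne
  refine ⟨?_, fun L hL => ?_⟩
  · obtain ⟨L, _, hL⟩ := exists_limit_lambdaOn (Z := Unit) hB (F := fun _ => F)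
      (fun j => (hFm j).comp measurable_snd) (fun _ => hF) hFm (fun _ _ _ => le_rfl) α hθ ht hfin
      (ζ := fun _ => z) measurable_const
    exact ⟨L (), (hiff _).mpr (hL ())⟩
  · have h := eLpNorm_limit_lambdaOn_le hB hK hF hFm hα hθ ht ((hiff L).mp hL)
    rw [eLpNorm_two_le_iff, ← ENNReal.rpow_natCast, ← ENNReal.rpow_mul] at h
    simpa using h

/-- Integrating the first moment bound over `z`: for fixed times the integral over `z` factors
into the `L¹` norms of the functions `f j (s j)`. -/
lemma lintegral_setLIntegral_simplex_le {f : Fin m → ℝ → EuclideanSpace ℝ (Fin d) → ℝ}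
    (hf : ∀ j, IsSmoothCompact T (f j)) {κ : Fin m → ℝ → ℝ} (hκm : ∀ j, Measurable (κ j))
    {θ t : ℝ} (hθ : 0 ≤ θ) (ht : t ≤ T) (p : ℝ) :
    ∫⁻ z : Fin m → EuclideanSpace ℝ (Fin d), ∫⁻ s in simplex m θ t, ENNReal.ofReal
        ((∏ j, |κ j (s j) * timeRestrict T (f j) (s j) (z j)|) * ∏ j, |gap θ s j| ^ p) ≤
      (∏ j, normLinftyL1 T (f j)) * ∫⁻ s in simplex m θ t,
        ENNReal.ofReal ((∏ j, |κ j (s j)|) * ∏ j, |gap θ s j| ^ p) := by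
  have hκ' : ∀ j, Measurable fun q : (Fin m → EuclideanSpace ℝ (Fin d)) × (Fin m → ℝ) =>
      κ j (q.2 j) := fun j => (hκm j).comp ((measurable_pi_apply j).comp measurable_snd)
  have hf' : ∀ j, Measurable fun q : (Fin m → EuclideanSpace ℝ (Fin d)) × (Fin m → ℝ) =>
      timeRestrict T (f j) (q.2 j) (q.1 j) := fun j => by
    have hg : Measurable fun q : (Fin m → EuclideanSpace ℝ (Fin d)) × (Fin m → ℝ) =>
      (q.2 j, q.1 j) := by fun_prop
    exact (hf j).measurable.comp hg
  have hgap : ∀ j, Measurable fun q : (Fin m → EuclideanSpace ℝ (Fin d)) × (Fin m → ℝ) =>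
      gap θ q.2 j := fun j => (measurable_gap j).comp measurable_snd
  have hmeas : Measurable fun q : (Fin m → EuclideanSpace ℝ (Fin d)) × (Fin m → ℝ) =>
      ENNReal.ofReal ((∏ j, |κ j (q.2 j) * timeRestrict T (f j) (q.2 j) (q.1 j)|) *
        ∏ j, |gap θ q.2 j| ^ p) := by
    refine (Measurable.mul ?_ ?_).ennreal_ofReal
    · exact Finset.measurable_prod _ fun j _ => ((hκ' j).mul (hf' j)).abs
    · exact Finset.measurable_prod _ fun j _ => ((hgap j).abs).pow_const _
  have hnorm : ∀ j, ∀ᵐ s : ℝ, s ∈ Set.Icc 0 T → ∫⁻ x, ‖f j s x‖ₑ ≤ normLinftyL1 T (f j) := fun j =>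
    (ae_restrict_iff' measurableSet_Icc).mp (ENNReal.ae_le_essSup _)
  rw [lintegral_lintegral_swap hmeas.aemeasurable]
  have hmeas2 : Measurable fun s : Fin m → ℝ =>
      ENNReal.ofReal ((∏ j, |κ j (s j)|) * ∏ j, |gap θ s j| ^ p) := by
    refine (Measurable.mul ?_ ?_).ennreal_ofReal
    · exact Finset.measurable_prod _ fun j _ => ((hκm j).comp (measurable_pi_apply j)).abs
    · exact Finset.measurable_prod _ fun j _ => ((measurable_gap j).abs).pow_const _
  rw [← lintegral_const_mul _ hmeas2]
  refine setLIntegral_mono_ae' (measurableSet_simplex m θ t) ?_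
  filter_upwards [ae_forall_coord hnorm] with s hs hsm
  have hI := mem_Icc_of_mem_simplex hθ ht hsm
  have e : ∀ z : Fin m → EuclideanSpace ℝ (Fin d), ENNReal.ofReal
      ((∏ j, |κ j (s j) * timeRestrict T (f j) (s j) (z j)|) * ∏ j, |gap θ s j| ^ p) =
      ENNReal.ofReal ((∏ j, |κ j (s j)|) * ∏ j, |gap θ s j| ^ p) *
        ∏ j, ‖timeRestrict T (f j) (s j) (z j)‖ₑ := by
    intro z
    simp_rw [← ofReal_norm, Real.norm_eq_abs]
    rw [← ENNReal.ofReal_prod_of_nonneg (fun _ _ => abs_nonneg _),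
      ← ENNReal.ofReal_mul (by positivity)]
    simp_rw [abs_mul]
    rw [Finset.prod_mul_distrib]
    congr 1
    ring
  simp_rw [e]
  rw [lintegral_const_mul' _ _ ENNReal.ofReal_ne_top, lintegral_fin_prod (f := fun j x =>
    ‖timeRestrict T (f j) (s j) x‖ₑ) (fun j =>
      ((hf j).measurable.comp measurable_prodMk_left).enorm), mul_comm]
  gcongr with j
  simp_rw [timeRestrict_of_mem (hI j)]
  exact hs j j (hI j)

end isLambda

/-! ### The random field and its first moment -/

section field

variable {Ω : Type*} [MeasurableSpace Ω] {P : Measure Ω} {d m k : ℕ} {H T K : ℝ}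
  {B B' : ℝ → Ω → EuclideanSpace ℝ (Fin d)}

/-- An integrable function on `[0, T]` agrees almost everywhere there with a measurable and
integrable function on the line. -/
lemma exists_measurable_integrable_eq {κ : ℝ → ℝ} (hκ : IntegrableOn κ (Set.Icc 0 T)) :
    ∃ κ' : ℝ → ℝ, Measurable κ' ∧ Integrable κ' ∧ ∀ᵐ s : ℝ, s ∈ Set.Icc 0 T → κ' s = κ s := by
  have hm : Measurable (hκ.1.mk κ) := hκ.1.stronglyMeasurable_mk.measurable
  refine ⟨(Set.Icc 0 T).indicator (hκ.1.mk κ), hm.indicator measurableSet_Icc, ?_, ?_⟩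
  · exact (integrable_indicator_iff measurableSet_Icc).mpr (hκ.congr hκ.1.ae_eq_mk)
  · filter_upwards [(ae_restrict_iff' measurableSet_Icc).mp hκ.1.ae_eq_mk] with s hs hI
    rw [Set.indicator_of_mem hI, hs hI]

/-- The time weights at the point `z` when `f` is multiplied by `κ`. -/
noncomputable def timeWeight (T : ℝ) (κ : Fin m → ℝ → ℝ)
    (f : Fin m → ℝ → EuclideanSpace ℝ (Fin d) → ℝ) (z : Fin m → EuclideanSpace ℝ (Fin d))
    (j : Fin m) (s : ℝ) : ℝ :=
  κ j s * timeRestrict T (f j) s (z j)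

variable {f : Fin m → ℝ → EuclideanSpace ℝ (Fin d) → ℝ} {κ : Fin m → ℝ → ℝ}

lemma measurable_timeWeight (hf : ∀ j, IsSmoothCompact T (f j)) (hκm : ∀ j, Measurable (κ j))
    (j : Fin m) : Measurable fun q : (Fin m → EuclideanSpace ℝ (Fin d)) × ℝ =>
      timeWeight T κ f q.1 j q.2 := by
  have hg : Measurable fun q : (Fin m → EuclideanSpace ℝ (Fin d)) × ℝ => (q.2, q.1 j) := by
    fun_prop
  exact ((hκm j).comp measurable_snd).mul ((hf j).measurable.comp hg)

lemma exists_timeWeight_bound (hf : ∀ j, IsSmoothCompact T (f j)) (κ : Fin m → ℝ → ℝ) :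
    ∃ M : ℝ, 0 ≤ M ∧ ∀ z j s, |timeWeight T κ f z j s| ≤ M * |κ j s| := by
  choose M hM0 hM using fun j => (hf j).exists_bound
  have h : ∀ j s x, |timeRestrict T (f j) s x| ≤ ∑ i, M i := fun j s x =>
    (hM j s x).trans (Finset.single_le_sum (fun i _ => hM0 i) (Finset.mem_univ j))
  refine ⟨∑ i, M i, Finset.sum_nonneg fun i _ => hM0 i, fun z j s => ?_⟩
  rw [timeWeight, abs_mul, mul_comm]
  exact mul_le_mul_of_nonneg_right (h j s _) (abs_nonneg _)

lemma integrable_timeWeight (hf : ∀ j, IsSmoothCompact T (f j)) (hκm : ∀ j, Measurable (κ j))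
    (hκ : ∀ j, Integrable (κ j)) (z : Fin m → EuclideanSpace ℝ (Fin d)) (j : Fin m) :
    Integrable (timeWeight T κ f z j) := by
  obtain ⟨M, hM0, hM⟩ := exists_timeWeight_bound hf κ
  refine ((hκ j).abs.const_mul M).mono
    ((measurable_timeWeight hf hκm j).comp measurable_prodMk_left).aestronglyMeasurable ?_
  refine Eventually.of_forall fun s => ?_
  rw [Real.norm_eq_abs, Real.norm_eq_abs]
  exact (hM z j s).trans (le_abs_self _)

/-- As a function of `z`, the quantity `Ψ` of the time weights is bounded and vanishes off a
compact set. -/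
lemma exists_Psi_timeWeight_le (k : ℕ) (H : ℝ) (hf : ∀ j, IsSmoothCompact T (f j))
    (κ : Fin m → ℝ → ℝ) {θ t : ℝ} (hθ : 0 ≤ θ) (ht : t ≤ T) :
    ∃ (M : ℝ≥0∞) (S : Set (Fin m → EuclideanSpace ℝ (Fin d))), M ≠ ∞ ∧ IsCompact S ∧
      (∀ z, Psi d k H (timeWeight T κ f z) θ t ≤ M * Psi d k H κ θ t) ∧
      ∀ z ∉ S, Psi d k H (timeWeight T κ f z) θ t = 0 := by
  obtain ⟨M, hM0, hM⟩ := exists_timeWeight_bound hf κ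
  choose S hS hS0 using fun j => (hf j).2
  refine ⟨ENNReal.ofReal ((M ^ 2) ^ m), Set.univ.pi S, ENNReal.ofReal_ne_top,
    isCompact_univ_pi hS, fun z => ?_, fun z hz => ?_⟩
  · exact Psi_le_of_abs_le d k H hM0 hθ ht fun j => Eventually.of_forall fun s _ => hM z j s
  · simp only [Set.mem_univ_pi, not_forall] at hz
    obtain ⟨j, hj⟩ := hz
    refine Psi_eq_zero d k H (j := j) (fun s => ?_) θ t
    rw [timeWeight]
    by_cases hs : s ∈ Set.Icc 0 T
    · rw [timeRestrict_of_mem hs, hS0 j s hs _ hj, mul_zero]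
    · rw [timeRestrict_of_notMem hs, mul_zero]

variable [IsProbabilityMeasure P]

/-- Existence of `Λ` as a jointly measurable field, for weights `κ j s * f j s x`. -/
theorem exists_isLambdaField (hB : HasFBMCharFun P H T B')
    (hBB' : ∀ᵐ ω ∂P, ∀ t ∈ Set.Icc 0 T, B' t ω = B t ω) (hK : MomentBound d k H T K)
    (hf : ∀ j, IsSmoothCompact T (f j)) {α : Fin m → Fin d → ℕ} (hα : ∀ j l, α j l ≤ k)
    {θ t : ℝ} (hθ : 0 ≤ θ) (ht : t ≤ T) (hκ : ∀ j, IntegrableOn (κ j) (Set.Icc 0 T))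
    (hΨ : Psi d k H κ θ t < ∞) :
    ∃ L : (Fin m → EuclideanSpace ℝ (Fin d)) → Ω → ℂ,
      IsLambdaField P B (fun j s x => κ j s * f j s x) α θ t L := by
  choose κ' hκm hκi hκe using fun j => exists_measurable_integrable_eq (hκ j)
  obtain ⟨M, hM0, hM⟩ := exists_timeWeight_bound hf κ'
  set G : Fin m → ℝ → ℝ := fun j s => M * κ' j s with hG
  have hGm : ∀ j, Measurable (G j) := fun j => (hκm j).const_mul M
  have habs : ∀ j s, |G j s| = M * |κ' j s| := fun j s => by rw [hG, abs_mul, abs_of_nonneg hM0]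
  have hfin : pairMoment H G α θ t Set.univ ≠ ∞ := by
    refine ((pairMoment_univ_le hθ ht hK hGm hα).trans_lt
      (ENNReal.mul_lt_top ENNReal.ofReal_lt_top ?_)).ne
    refine (Psi_le_of_abs_le d k H hM0 hθ ht fun j => Eventually.of_forall fun s _ =>
      (habs j s).le).trans_lt (ENNReal.mul_lt_top ENNReal.ofReal_lt_top ?_)
    rwa [Psi_congr d k H hθ ht hκe]
  obtain ⟨L, hLm, hL⟩ := exists_limit_lambdaOn hB (measurable_timeWeight hf hκm)
    (integrable_timeWeight hf hκm hκi) hGm (fun z j s => (hM z j s).trans (habs j s).ge) α hθ ht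
    hfin (ζ := id) measurable_id
  refine ⟨L, hLm, fun z => (isLambda_iff hBB' hθ ht (fun j => ?_)).mpr (hL z)⟩
  filter_upwards [hκe j] with s hs hI
  rw [timeWeight, hs hI, timeRestrict_of_mem hI]

/-- Integrability and the first moment of `Λ` as a field. The second moment of `Λ` at `z` is
bounded in `z` and vanishes off a compact set, hence integrability; the order of integration may
then be exchanged, and the expectations are integrated over `z`. -/
theorem IsLambdaField.integrable_and_bound (hB : HasFBMCharFun P H T B')
    (hBB' : ∀ᵐ ω ∂P, ∀ t ∈ Set.Icc 0 T, B' t ω = B t ω) (hH : 0 < H) (hK : MomentBound d k H T K)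
    (hf : ∀ j, IsSmoothCompact T (f j)) {α : Fin m → Fin d → ℕ} (hα : ∀ j l, α j l ≤ k)
    {θ t : ℝ} (hθ : 0 ≤ θ) (ht : t ≤ T) (hκ : ∀ j, IntegrableOn (κ j) (Set.Icc 0 T))
    (hΨ : Psi d k H κ θ t < ∞) {L : (Fin m → EuclideanSpace ℝ (Fin d)) → Ω → ℂ}
    (hL : IsLambdaField P B (fun j s x => κ j s * f j s x) α θ t L) :
    Integrable (Function.uncurry L) (volume.prod P) ∧
      ‖∫ ω, (∫ z, L z ω) ∂P‖ₑ ≤ ENNReal.ofReal (K ^ m) * (∏ j, normLinftyL1 T (f j)) *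
        Psi d k H κ θ t ^ (1 / 2 : ℝ) := by
  choose κ' hκm hκi hκe using fun j => exists_measurable_integrable_eq (hκ j)
  have hΨeq : Psi d k H κ' θ t = Psi d k H κ θ t := Psi_congr d k H hθ ht hκe
  rw [← hΨeq] at hΨ ⊢
  have hFm : ∀ z j, Measurable (timeWeight T κ' f z j) := fun z j =>
    (measurable_timeWeight hf hκm j).comp measurable_prodMk_left
  have hF := integrable_timeWeight hf hκm hκi
  have hLz := fun z => (isLambda_iff (F := timeWeight T κ' f z) hBB' hθ ht (fun j => by
    filter_upwards [hκe j] with s hs hI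
    rw [timeWeight, hs hI, timeRestrict_of_mem hI])).mp (hL.2 z)
  have hnorm : ∀ z, ∫⁻ ω, ‖L z ω‖ₑ ∂P ≤
      (ENNReal.ofReal ((K ^ 2) ^ m) * Psi d k H (timeWeight T κ' f z) θ t) ^ (1 / 2 : ℝ) := by
    intro z
    rw [← eLpNorm_one_eq_lintegral_enorm]
    exact (eLpNorm_le_eLpNorm_of_exponent_le one_le_two (hLz z).2.1.1).trans
      (eLpNorm_limit_lambdaOn_le hB hK (hF z) (hFm z) hα hθ ht (hLz z))
  have hint : Integrable (Function.uncurry L) (volume.prod P) := by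
    obtain ⟨M, S, hM, hS, hle, hzero⟩ := exists_Psi_timeWeight_le k H hf κ' hθ ht
    refine ⟨hL.1.aestronglyMeasurable, ?_⟩
    rw [HasFiniteIntegral, lintegral_prod _ hL.1.enorm.aemeasurable]
    set b := (ENNReal.ofReal ((K ^ 2) ^ m) * (M * Psi d k H κ' θ t)) ^ (1 / 2 : ℝ) with hb
    have hbt : b < ∞ := ENNReal.rpow_lt_top_of_nonneg (by norm_num)
      (ENNReal.mul_ne_top ENNReal.ofReal_ne_top (ENNReal.mul_ne_top hM hΨ.ne))
    calc ∫⁻ z, ∫⁻ ω, ‖Function.uncurry L (z, ω)‖ₑ ∂P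
        ≤ ∫⁻ z, S.indicator (fun _ => b) z := by
          refine lintegral_mono fun z => (hnorm z).trans ?_
          by_cases hz : z ∈ S
          · rw [Set.indicator_of_mem hz, hb]
            gcongr
            exact hle z
          · rw [Set.indicator_of_notMem hz, hzero z hz, mul_zero,
              ENNReal.zero_rpow_of_pos (by norm_num)]
      _ = b * volume S := lintegral_indicator_const hS.measurableSet b
      _ < ∞ := ENNReal.mul_lt_top hbt hS.measure_lt_top
  refine ⟨hint, ?_⟩
  have hmean : ∀ z, ‖∫ ω, L z ω ∂P‖ₑ ≤ ENNReal.ofReal (K ^ m) * ∫⁻ s in simplex m θ t,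
      ENNReal.ofReal ((∏ j, |κ' j (s j) * timeRestrict T (f j) (s j) (z j)|) *
        ∏ j, |gap θ s j| ^ (-(d * H * (2 * k + 1)))) := fun z =>
    enorm_integral_limit_le (hLz z).1 (hLz z).2.1 (hLz z).2.2 fun R =>
      enorm_integral_lambdaOn_le hB hK (hF z) (hFm z) hα hθ ht z (isBounded_freqBall R)
  rw [← integral_integral_swap hint]
  calc ‖∫ z, ∫ ω, L z ω ∂P‖ₑ
      ≤ ∫⁻ z, ‖∫ ω, L z ω ∂P‖ₑ := enorm_integral_le_lintegral_enorm _
    _ ≤ ∫⁻ z : Fin m → EuclideanSpace ℝ (Fin d), ENNReal.ofReal (K ^ m) *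
          ∫⁻ s in simplex m θ t, ENNReal.ofReal
            ((∏ j, |κ' j (s j) * timeRestrict T (f j) (s j) (z j)|) *
              ∏ j, |gap θ s j| ^ (-(d * H * (2 * k + 1)))) := lintegral_mono hmean
    _ ≤ ENNReal.ofReal (K ^ m) * ((∏ j, normLinftyL1 T (f j)) * ∫⁻ s in simplex m θ t,
          ENNReal.ofReal ((∏ j, |κ' j (s j)|) *
            ∏ j, |gap θ s j| ^ (-(d * H * (2 * k + 1))))) := by
        rw [lintegral_const_mul' _ _ ENNReal.ofReal_ne_top]
        gcongr
        exact lintegral_setLIntegral_simplex_le hf hκm hθ ht _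
    _ ≤ ENNReal.ofReal (K ^ m) * ((∏ j, normLinftyL1 T (f j)) *
          Psi d k H κ' θ t ^ (1 / 2 : ℝ)) := by
        gcongr
        rw [one_div, ENNReal.le_rpow_inv_iff (by norm_num), ENNReal.rpow_ofNat]
        exact sq_setLIntegral_simplex_le_Psi d k hH hκm θ t
    _ = _ := by ring

end field

end FBMLocalTime

theorem mainTheorem4 (d k : ℕ) (hd : 1 ≤ d) (H T : ℝ) (hH : 0 < H) (hH' : H < 1 / 2)
    (hT : 0 < T) :
    ∃ C : ℝ, 0 < C ∧
      ∀ (Ω : Type*) [MeasurableSpace Ω] (P : Measure Ω) [IsProbabilityMeasure P]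
        (B : ℝ → Ω → EuclideanSpace ℝ (Fin d)), FBMLocalTime.IsFBM P d H T B →
      ∀ (m : ℕ), 1 ≤ m →
      ∀ (f : Fin m → ℝ → EuclideanSpace ℝ (Fin d) → ℝ),
        (∀ j, FBMLocalTime.IsSmoothCompact T (f j)) →
      ∀ (α : Fin m → Fin d → ℕ), (∀ j l, α j l ≤ k) →
      ∀ (θ t : ℝ), 0 ≤ θ → θ < t → t ≤ T →
        (∀ z : Fin m → EuclideanSpace ℝ (Fin d),
          FBMLocalTime.Psi d k H (fun j s => f j s (z j)) θ t < ∞ →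
          (∃ L : Ω → ℂ, FBMLocalTime.IsLambda P B f α θ t z L) ∧
          ∀ L : Ω → ℂ, FBMLocalTime.IsLambda P B f α θ t z L →
            ∫⁻ ω, ‖L ω‖ₑ ^ 2 ∂P ≤
              ENNReal.ofReal (C ^ m) *
                FBMLocalTime.Psi d k H (fun j s => f j s (z j)) θ t) ∧
        (∀ κ : Fin m → ℝ → ℝ, (∀ j, IntegrableOn (κ j) (Set.Icc 0 T)) →
          FBMLocalTime.Psi d k H κ θ t < ∞ →
          (∃ L : (Fin m → EuclideanSpace ℝ (Fin d)) → Ω → ℂ,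
            FBMLocalTime.IsLambdaField P B (fun j s x => κ j s * f j s x) α θ t L) ∧
          ∀ L : (Fin m → EuclideanSpace ℝ (Fin d)) → Ω → ℂ,
            FBMLocalTime.IsLambdaField P B (fun j s x => κ j s * f j s x) α θ t L →
            Integrable (Function.uncurry L) (volume.prod P) ∧
            ‖∫ ω, (∫ z, L z ω) ∂P‖ₑ ≤
              ENNReal.ofReal (C ^ m) * (∏ j, FBMLocalTime.normLinftyL1 T (f j)) *
                FBMLocalTime.Psi d k H κ θ t ^ (1 / 2 : ℝ)) := by
  obtain ⟨K, hK⟩ := FBMLocalTime.exists_lintegral_moment_le d k T hH hH'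
  have hK1 : 1 ≤ K := hK.1
  refine ⟨K ^ 2, by positivity, ?_⟩
  intro Ω _ P _ B hB m _ f hf α hα θ t hθ _ ht
  obtain ⟨B', hB', hBB'⟩ := hB.exists_hasFBMCharFun hT.le
  refine ⟨fun z hΨ => FBMLocalTime.exists_isLambda hB' hBB' hK hf hα hθ ht z hΨ,
    fun κ hκ hΨ => ⟨FBMLocalTime.exists_isLambdaField hB' hBB' hK hf hα hθ ht hκ hΨ,
      fun L hL => ?_⟩⟩
  obtain ⟨hint, hle⟩ := hL.integrable_and_bound hB' hBB' hH hK hf hα hθ ht hκ hΨ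
  refine ⟨hint, hle.trans ?_⟩
  -- the first moment needs only `K`, the second one `K ^ 2`
  gcongr
  exact le_self_pow₀ hK1 two_ne_zero
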